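/- Let $\mathcal H$ be a separable complex Hilbert space, let $-\infty\le a<b\le\infty$, and let $V:(a,b)\to\mathcal B(\mathcal H)$ be weakly measurable (i.e. $x\mapsto (f,V(x)g)_{\mathcal H}$ is Lebesgue measurable for all $f,g\in\mathcal H$) with $\|V(\cdot)\|_{\mathcal B(\mathcal H)}\in L^1_{\mathrm{loc}}((a,b);dx)$ and $V(x)=V(x)^*$ for a.e. $x\in(a,b)$. Let $W^{2,1}_{\mathrm{loc}}((a,b);dx;\mathcal H)$ be the set of $\mathcal H$-valued functions $f$ on $(a,b)$ that are, together with their strong derivatives $f'$ and $f''$, in $L^1_{\mathrm{loc}}((a,b);dx;\mathcal H)$; here $g\in L^1_{\mathrm{loc}}$ is the strong derivative of $f\in L^1_{\mathrm{loc}}$ if there are $x_0\in(a,b)$ and $c\in\mathcal H$ with $f(x)=c+\int_{x_0}^x g(t)\,dt$ (Bochner integral) for a.e. $x\in(a,b)$. Put $\tau f=-f''+Vf$. In the Hilbert space $L^2((a,b);dx;\mathcal H)$ define the maximal operator $H_{\max}f=\tau f$ with $$\operatorname{dom}(H_{\max})=\{f\in L^2((a,b);dx;\mathcal H)\mid f\in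 W^{2,1}_{\mathrm{loc}}((a,b);dx;\mathcal H),\ \tau f\in L^2((a,b);dx;\mathcal H)\},$$ and let the preminimal operator $\dot H_{\min}$ be the restriction of $H_{\max}$ to those $f\in\operatorname{dom}(H_{\max})$ whose support is a compact subset of $(a,b)$. Then $\dot H_{\min}$ is densely defined, and $H_{\max}=(\dot H_{\min})^*$; in particular, $H_{\max}$ is closed. Moreover, $\dot H_{\min}$ is symmetric, hence closable, and, with $H_{\min}:=\overline{\dot H_{\min}}$ denoting its closure (the minimal operator), $$H_{\max}^*=\overline{\dot H_{\min}}=H_{\min}.$$ -/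

import Mathlib

open MeasureTheory Set Filter Topology
open scoped ENNReal LinearPMap

namespace OperatorSchrodinger

/-- The real open interval `(a, b)` whose endpoints may be infinite. -/
def interval (a b : EReal) : Set ℝ := {x : ℝ | a < (x : EReal) ∧ (x : EReal) < b}

/-- Lebesgue measure on `(a, b)`. -/
noncomputable abbrev vol (a b : EReal) : Measure ℝ := volume.restrict (interval a b)

/-- The Hilbert space `L²((a, b); dx; H)`. Its inner product is
`⟪f, g⟫ = ∫ ⟪f x, g x⟫ dx`, linear in the second argument. -/
noncomputable abbrev L2 (a b : EReal) (H : Type*) [NormedAddCommGroup H] :=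
  Lp H 2 (vol a b)

theorem isOpen_interval (a b : EReal) : IsOpen (interval a b) :=
  (isOpen_Ioo (a := a) (b := b)).preimage continuous_coe_real_ereal

theorem measurableSet_interval (a b : EReal) : MeasurableSet (interval a b) :=
  (isOpen_interval a b).measurableSet

theorem ordConnected_interval (a b : EReal) : (interval a b).OrdConnected := by
  refine ⟨fun x hx y hy z hz => ⟨?_, ?_⟩⟩
  · exact hx.1.trans_le (EReal.coe_le_coe_iff.2 hz.1)
  · exact (EReal.coe_le_coe_iff.2 hz.2).trans_lt hy.2

variable {H : Type*} [NormedAddCommGroup H] [InnerProductSpace ℂ H]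

/-- `f` is strongly locally absolutely continuous on `(a, b)` (that is,
`f ∈ W^{1,1}_loc((a, b); dx; H)`) with strong derivative `g ∈ L¹_loc((a, b); dx; H)`:
`f x = c + ∫_{x₀}^x g` for a.e. `x ∈ (a, b)`. Here `c` is the value at `x₀` of the continuous
representative of `f`. -/
structure HasStrongDeriv (a b : EReal) (f g : ℝ → H) : Prop where
  locInt : LocallyIntegrableOn f (interval a b) volume
  locInt_deriv : LocallyIntegrableOn g (interval a b) volume
  primitive : ∃ x₀ ∈ interval a b, ∃ c : H, ∀ᵐ x ∂(vol a b), f x = c + ∫ t in x₀..x, g t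

open Classical in
/-- The strong derivative of `f` on `(a, b)`; it is unique up to equality almost everywhere
(see `HasStrongDeriv.unique`), and it is `0` by convention if `f ∉ W^{1,1}_loc`. -/
noncomputable def strongDeriv (a b : EReal) (f : ℝ → H) : ℝ → H :=
  if h : ∃ g, HasStrongDeriv a b f g then h.choose else 0

/-- `f ∈ W^{2,1}_loc((a, b); dx; H)`: the strong derivatives `f'` and `f''` exist, and
`f`, `f'`, `f''` are locally integrable. -/
def MemW21loc (a b : EReal) (f : ℝ → H) : Prop :=
  (∃ g, HasStrongDeriv a b f g) ∧ ∃ g, HasStrongDeriv a b (strongDeriv a b f) g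

/-- The differential expression `τ f = - f'' + V f`. -/
noncomputable def tau (a b : EReal) (V : ℝ → H →L[ℂ] H) (f : ℝ → H) : ℝ → H :=
  fun x => - strongDeriv a b (strongDeriv a b f) x + V x (f x)

section basic

variable {a b : EReal}

theorem HasStrongDeriv.intervalIntegrable {f g : ℝ → H} (h : HasStrongDeriv a b f g)
    {x y : ℝ} (hx : x ∈ interval a b) (hy : y ∈ interval a b) :
    IntervalIntegrable g volume x y :=
  intervalIntegrable_iff.2 <|
    (h.locInt_deriv.integrableOn_compact_subset
      ((ordConnected_interval a b).uIcc_subset hx hy) isCompact_uIcc).mono_set uIoc_subset_uIcc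

theorem HasStrongDeriv.congr {f f' g : ℝ → H} (h : HasStrongDeriv a b f g)
    (hf : f =ᵐ[vol a b] f') : HasStrongDeriv a b f' g where
  locInt := h.locInt.congr hf
  locInt_deriv := h.locInt_deriv
  primitive := by
    obtain ⟨x₀, hx₀, c, hc⟩ := h.primitive
    exact ⟨x₀, hx₀, c, by filter_upwards [hc, hf] with x h1 h2; rw [← h2, h1]⟩

theorem HasStrongDeriv.add {f f' g g' : ℝ → H} (h : HasStrongDeriv a b f g)
    (h' : HasStrongDeriv a b f' g') : HasStrongDeriv a b (f + f') (g + g') where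
  locInt := h.locInt.add h'.locInt
  locInt_deriv := h.locInt_deriv.add h'.locInt_deriv
  primitive := by
    obtain ⟨x₀, hx₀, c, hc⟩ := h.primitive
    obtain ⟨x₁, hx₁, c', hc'⟩ := h'.primitive
    refine ⟨x₀, hx₀, c + (c' + ∫ t in x₁..x₀, g' t), ?_⟩
    filter_upwards [hc, hc', ae_restrict_mem (measurableSet_interval a b)] with x h1 h2 hx
    have e1 := intervalIntegral.integral_add (h.intervalIntegrable hx₀ hx)
      (h'.intervalIntegrable hx₀ hx)
    have e2 := intervalIntegral.integral_add_adjacent_intervals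
      (h'.intervalIntegrable hx₁ hx₀) (h'.intervalIntegrable hx₀ hx)
    simp only [Pi.add_apply, h1, h2, e1, ← e2]
    abel

theorem HasStrongDeriv.smul {f g : ℝ → H} (k : ℂ) (h : HasStrongDeriv a b f g) :
    HasStrongDeriv a b (k • f) (k • g) where
  locInt := h.locInt.smul k
  locInt_deriv := h.locInt_deriv.smul k
  primitive := by
    obtain ⟨x₀, hx₀, c, hc⟩ := h.primitive
    refine ⟨x₀, hx₀, k • c, ?_⟩
    filter_upwards [hc] with x h1
    simp only [Pi.smul_apply, h1, smul_add, intervalIntegral.integral_smul]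

theorem HasStrongDeriv.zero (hab : a < b) :
    HasStrongDeriv a b (0 : ℝ → H) (0 : ℝ → H) where
  locInt := (locallyIntegrable_zero).locallyIntegrableOn _
  locInt_deriv := (locallyIntegrable_zero).locallyIntegrableOn _
  primitive := by
    obtain ⟨x, h1, h2⟩ := EReal.lt_iff_exists_real_btwn.1 hab
    exact ⟨x, ⟨h1, h2⟩, 0, by simp⟩

theorem HasStrongDeriv.eq_zero [CompleteSpace H] {g : ℝ → H}
    (h : HasStrongDeriv a b (0 : ℝ → H) g) : g =ᵐ[vol a b] 0 := by
  obtain ⟨x₀, hx₀, c, hc⟩ := h.primitive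
  rw [EventuallyEq, ae_restrict_iff' (measurableSet_interval a b), ae_iff]
  refine measure_null_of_locally_null _ fun x hx => ?_
  obtain ⟨hxI, -⟩ : x ∈ interval a b ∧ ¬ g x = 0 := by simpa using hx
  have hmin : min x x₀ ∈ interval a b := by
    rcases min_choice x x₀ with e | e <;> rw [e] <;> assumption
  have hmax : max x x₀ ∈ interval a b := by
    rcases max_choice x x₀ with e | e <;> rw [e] <;> assumption
  obtain ⟨α, hα, hα'⟩ := EReal.lt_iff_exists_real_btwn.1 hmin.1
  obtain ⟨β, hβ', hβ⟩ := EReal.lt_iff_exists_real_btwn.1 hmax.2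
  rw [EReal.coe_lt_coe_iff] at hα' hβ'
  have hαI : α ∈ interval a b := ⟨hα, (EReal.coe_lt_coe_iff.2 hα').trans hmin.2⟩
  have hβI : β ∈ interval a b := ⟨hmax.1.trans (EReal.coe_lt_coe_iff.2 hβ'), hβ⟩
  have hαβ : α ≤ β := (hα'.trans_le ((min_le_left x x₀).trans (le_max_left x x₀))).le.trans hβ'.le
  have hx₀' : x₀ ∈ uIcc α β := by
    rw [uIcc_of_le hαβ]
    exact ⟨hα'.le.trans (min_le_right _ _), (le_max_right _ _).trans hβ'.le⟩
  have hsub : Ioo α β ⊆ interval a b :=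
    Ioo_subset_Icc_self.trans ((ordConnected_interval a b).out hαI hβI)
  have hint := h.intervalIntegrable hαI hβI
  have hcont : ContinuousOn (fun y => c + ∫ t in x₀..y, g t) (Ioo α β) := by
    refine continuousOn_const.add
      ((intervalIntegral.continuousOn_primitive_interval' hint hx₀').mono ?_)
    rw [uIcc_of_le hαβ]
    exact Ioo_subset_Icc_self
  have hEq : EqOn (fun y => c + ∫ t in x₀..y, g t) (fun _ => (0 : H)) (Ioo α β) := by
    refine Measure.eqOn_open_of_ae_eq (μ := volume) ?_ isOpen_Ioo hcont continuousOn_const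
    have := ae_restrict_of_ae_restrict_of_subset hsub hc
    filter_upwards [this] with y hy
    simpa using hy.symm
  have hnull : volume {y | ¬ (y ∈ uIcc α β → ∀ d ∈ uIcc α β,
      HasDerivAt (fun z => ∫ t in d..z, g t) (g y) y)} = 0 := ae_iff.1 hint.ae_hasDerivAt_integral
  refine ⟨Ioo α β ∩ _, inter_mem (mem_nhdsWithin_of_mem_nhds (Ioo_mem_nhds
    (hα'.trans_le (min_le_left _ _)) ((le_max_left _ _).trans_lt hβ'))) self_mem_nhdsWithin,
    measure_mono_null ?_ hnull⟩
  rintro y ⟨hy, hy'⟩ hcon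
  obtain ⟨-, hgy⟩ : y ∈ interval a b ∧ ¬ g y = 0 := by simpa using hy'
  have hd := (hcon (by rw [uIcc_of_le hαβ]; exact Ioo_subset_Icc_self hy) x₀ hx₀').const_add c
  have hd0 : HasDerivAt (fun z => c + ∫ t in x₀..z, g t) 0 y :=
    (hasDerivAt_const y (0 : H)).congr_of_eventuallyEq
      (hEq.eventuallyEq_of_mem (Ioo_mem_nhds hy.1 hy.2))
  exact hgy (hd.unique hd0)

/-- The strong derivative is unique almost everywhere. -/
theorem HasStrongDeriv.unique [CompleteSpace H] {f g g' : ℝ → H} (h : HasStrongDeriv a b f g)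
    (h' : HasStrongDeriv a b f g') : g =ᵐ[vol a b] g' := by
  have h0 : HasStrongDeriv a b (0 : ℝ → H) (g + (-1 : ℂ) • g') :=
    (h.add (h'.smul (-1))).congr (by simp)
  filter_upwards [h0.eq_zero] with x hx
  simpa [← sub_eq_add_neg, sub_eq_zero] using hx

theorem hasStrongDeriv_strongDeriv {f : ℝ → H} (h : ∃ g, HasStrongDeriv a b f g) :
    HasStrongDeriv a b f (strongDeriv a b f) := by
  rw [strongDeriv, dif_pos h]
  exact h.choose_spec

theorem HasStrongDeriv.strongDeriv_ae [CompleteSpace H] {f g : ℝ → H}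
    (h : HasStrongDeriv a b f g) : strongDeriv a b f =ᵐ[vol a b] g :=
  (hasStrongDeriv_strongDeriv ⟨g, h⟩).unique h

theorem memW21loc_of [CompleteSpace H] {f g k : ℝ → H} (h : HasStrongDeriv a b f g)
    (h' : HasStrongDeriv a b g k) :
    MemW21loc a b f ∧ strongDeriv a b (strongDeriv a b f) =ᵐ[vol a b] k := by
  have h2 : HasStrongDeriv a b (strongDeriv a b f) k := h'.congr h.strongDeriv_ae.symm
  exact ⟨⟨⟨g, h⟩, ⟨k, h2⟩⟩, h2.strongDeriv_ae⟩

theorem tau_zero [CompleteSpace H] (hab : a < b) (V : ℝ → H →L[ℂ] H) {f : ℝ → H}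
    (hf : f =ᵐ[vol a b] 0) : MemW21loc a b f ∧ tau a b V f =ᵐ[vol a b] 0 := by
  obtain ⟨h1, h2⟩ := memW21loc_of ((HasStrongDeriv.zero hab).congr hf.symm)
    (HasStrongDeriv.zero hab)
  refine ⟨h1, ?_⟩
  filter_upwards [h2, hf] with x hx hx'
  simp [tau, hx, hx']

theorem tau_add [CompleteSpace H] (V : ℝ → H →L[ℂ] H) {f g k : ℝ → H}
    (hf : MemW21loc a b f) (hg : MemW21loc a b g) (hk : k =ᵐ[vol a b] f + g) :
    MemW21loc a b k ∧ tau a b V k =ᵐ[vol a b] tau a b V f + tau a b V g := by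
  obtain ⟨h1, h2⟩ := memW21loc_of
    (((hasStrongDeriv_strongDeriv hf.1).add (hasStrongDeriv_strongDeriv hg.1)).congr hk.symm)
    ((hasStrongDeriv_strongDeriv hf.2).add (hasStrongDeriv_strongDeriv hg.2))
  refine ⟨h1, ?_⟩
  filter_upwards [h2, hk] with x hx hx'
  simp only [tau, hx, hx', Pi.add_apply, map_add, neg_add]
  abel

theorem tau_smul [CompleteSpace H] (V : ℝ → H →L[ℂ] H) (c : ℂ) {f k : ℝ → H}
    (hf : MemW21loc a b f) (hk : k =ᵐ[vol a b] c • f) :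
    MemW21loc a b k ∧ tau a b V k =ᵐ[vol a b] c • tau a b V f := by
  obtain ⟨h1, h2⟩ := memW21loc_of
    (((hasStrongDeriv_strongDeriv hf.1).smul c).congr hk.symm)
    ((hasStrongDeriv_strongDeriv hf.2).smul c)
  refine ⟨h1, ?_⟩
  filter_upwards [h2, hk] with x hx hx'
  simp only [tau, hx, hx', Pi.smul_apply, map_smul, smul_add, smul_neg]

end basic

variable [CompleteSpace H]

/-- `dom(H_max)`: all `f ∈ L²((a, b); dx; H)` with `f ∈ W^{2,1}_loc` and `τ f ∈ L²`. -/
def maxDomain {a b : EReal} (hab : a < b) (V : ℝ → H →L[ℂ] H) : Submodule ℂ (L2 a b H) where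
  carrier := {f | MemW21loc a b f ∧ MemLp (tau a b V f) 2 (vol a b)}
  zero_mem' := by
    obtain ⟨h1, h2⟩ := tau_zero hab V (Lp.coeFn_zero H 2 (vol a b))
    exact ⟨h1, (memLp_congr_ae h2).2 MemLp.zero⟩
  add_mem' := by
    rintro f g ⟨hf, hf'⟩ ⟨hg, hg'⟩
    obtain ⟨h1, h2⟩ := tau_add V hf hg (Lp.coeFn_add f g)
    exact ⟨h1, (memLp_congr_ae h2).2 (hf'.add hg')⟩
  smul_mem' := by
    rintro c f ⟨hf, hf'⟩
    obtain ⟨h1, h2⟩ := tau_smul V c hf (Lp.coeFn_smul c f)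
    exact ⟨h1, (memLp_congr_ae h2).2 (hf'.const_smul c)⟩

/-- The maximal operator `H_max f = τ f` on `dom(H_max)`. -/
noncomputable def Hmax {a b : EReal} (hab : a < b) (V : ℝ → H →L[ℂ] H) :
    L2 a b H →ₗ.[ℂ] L2 a b H where
  domain := maxDomain hab V
  toFun :=
    { toFun := fun f => MemLp.toLp (tau a b V (f : L2 a b H)) f.2.2
      map_add' := fun f g => by
        rw [← MemLp.toLp_add]
        exact MemLp.toLp_congr _ _ (tau_add V f.2.1 g.2.1 (Lp.coeFn_add (f : L2 a b H) g)).2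
      map_smul' := fun c f => by
        rw [RingHom.id_apply, ← MemLp.toLp_const_smul]
        exact MemLp.toLp_congr _ _ (tau_smul V c f.2.1 (Lp.coeFn_smul c (f : L2 a b H))).2 }

/-- The elements of `L²((a, b); dx; H)` whose (essential) support is a compact subset of
`(a, b)`. -/
def compactlySupported (a b : EReal) (H : Type*) [NormedAddCommGroup H]
    [InnerProductSpace ℂ H] : Submodule ℂ (L2 a b H) where
  carrier := {f | ∃ K : Set ℝ, IsCompact K ∧ K ⊆ interval a b ∧
    ∀ᵐ x ∂(vol a b), x ∉ K → f x = 0}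
  zero_mem' := by
    refine ⟨∅, isCompact_empty, empty_subset _, ?_⟩
    filter_upwards [Lp.coeFn_zero H 2 (vol a b)] with x hx _
    exact hx
  add_mem' := by
    rintro f g ⟨K, hK, hKI, hf⟩ ⟨L, hL, hLI, hg⟩
    refine ⟨K ∪ L, hK.union hL, union_subset hKI hLI, ?_⟩
    filter_upwards [hf, hg, Lp.coeFn_add f g] with x h1 h2 h3 hx
    rw [mem_union, not_or] at hx
    rw [h3, Pi.add_apply, h1 hx.1, h2 hx.2, add_zero]
  smul_mem' := by
    rintro c f ⟨K, hK, hKI, hf⟩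
    refine ⟨K, hK, hKI, ?_⟩
    filter_upwards [hf, Lp.coeFn_smul c f] with x h1 h2 hx
    rw [h2, Pi.smul_apply, h1 hx, smul_zero]

/-- The preminimal operator: the restriction of `H_max` to the elements of `dom(H_max)` that
have compact support in `(a, b)`. -/
noncomputable def HminDot {a b : EReal} (hab : a < b) (V : ℝ → H →L[ℂ] H) :
    L2 a b H →ₗ.[ℂ] L2 a b H :=
  (Hmax hab V).domRestrict (compactlySupported a b H)

/-- The minimal operator, the closure of the preminimal operator. -/
noncomputable def Hmin {a b : EReal} (hab : a < b) (V : ℝ → H →L[ℂ] H) :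
    L2 a b H →ₗ.[ℂ] L2 a b H :=
  (HminDot hab V).closure

/-- The standing hypothesis on the potential: `V` is weakly measurable on `(a, b)`, `‖V(·)‖` is
locally integrable on `(a, b)`, and `V(x)` is self-adjoint for a.e. `x ∈ (a, b)`. -/
structure IsPotential (a b : EReal) (V : ℝ → H →L[ℂ] H) : Prop where
  weaklyMeasurable : ∀ f g : H, AEMeasurable (fun x => inner ℂ f (V x g)) (vol a b)
  locInt_norm : LocallyIntegrableOn (fun x => ‖V x‖) (interval a b) volume
  selfAdjoint : ∀ᵐ x ∂(vol a b), IsSelfAdjoint (V x)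

end OperatorSchrodinger

/-!
The heart of the matter is the inclusion of the adjoint of the preminimal operator in the maximal
one: if `⟪h, g⟫ = ⟪f, τ g⟫` for all `g` in the preminimal domain, then `f ∈ W^{2,1}_loc` and
`τ f = h` (`IsPotential.exists_mem_Hmax_of_weak`). As `V` is only locally integrable, smooth
functions of compact support need not belong to the preminimal domain, and test functions have to
be manufactured from the differential equation itself.

This is done near each point, on an interval `[α, β]` with `(β - α) ∫ ‖V‖ ≤ 1/5`. There the Volterra
operator `T y = ∫∫ V y` is a contraction, so Cauchy problems are solved by inverting `1 - T`
(`IsPotential.exists_resolvent`). Let `v` be a solution of `τ v = h` with zero data at `α`, and let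
`N` be the space of solutions of `τ n = 0`. If `k ∈ L²` is orthogonal to `N`, then the solution of
`τ g = k` with zero data at `α` also has zero data at `β`, by Lagrange's identity
(`IsPotential.lagrange`) applied to `g` and to suitable `n ∈ N`. Extended by zero, `g` is a test
function (`exists_mem_HminDot`), and Lagrange's identity for `v` and `g` gives `⟪f - v, k⟫ = 0`. Hence
`f - v ∈ Nᗮᗮ`, which is `N` because `N` is closed. In infinite dimensions closedness needs an
argument: null solutions are uniformly close to affine functions, so their `L²` norm controls their
Cauchy data (`IsPotential.exists_solutionSpace`). So `f` solves `τ f = h` near each point, and the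
local solutions are glued by comparison with one global second primitive
(`exists_hasStrongDeriv_of_locally`).

With `f = 0` this shows that the preminimal domain is dense. The reverse inclusion is Lagrange's
identity on an interval outside which the test function vanishes (`IsPotential.isFormalAdjoint`).
The remaining claims are general facts on adjoints, in particular that the second adjoint of a
linear relation is its closure (`adjoint_adjoint_eq_topologicalClosure`).

Two facts on vector-valued functions are needed: weakly measurable functions into a
separable Hilbert space are strongly measurable (`aestronglyMeasurable_of_inner`), and the product
rule holds for the inner product of absolutely continuous functions (`IsPrimitiveOn.innerProduct`).
-/

namespace OperatorSchrodinger

/-! ### Absolutely continuous functions on a compact interval -/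

/-- `f` is (strongly) absolutely continuous on `[α, β]` with derivative `F ∈ L¹`, expressed through
increments, so that no base point is distinguished. -/
structure IsPrimitiveOn {E : Type*} [NormedAddCommGroup E] [NormedSpace ℝ E]
    (α β : ℝ) (f F : ℝ → E) : Prop where
  intervalIntegrable : IntervalIntegrable F volume α β
  sub_eq : ∀ x ∈ Icc α β, ∀ y ∈ Icc α β, f y - f x = ∫ t in x..y, F t

section primitive

variable {E : Type*} [NormedAddCommGroup E] [NormedSpace ℝ E] {α β : ℝ} {f g F G : ℝ → E}

omit [NormedSpace ℝ E] in
theorem intervalIntegrable_of_mem_Icc {f : ℝ → E} (h : IntervalIntegrable f volume α β)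
    {x y : ℝ} (hx : x ∈ Icc α β) (hy : y ∈ Icc α β) : IntervalIntegrable f volume x y := by
  refine h.mono_set ?_
  rw [uIcc_of_le (hx.1.trans hx.2)]
  exact uIcc_subset_Icc hx hy

theorem isPrimitiveOn_of_base {x₀ : ℝ} {c : E} (hx₀ : x₀ ∈ Icc α β)
    (hF : IntervalIntegrable F volume α β) (h : ∀ x ∈ Icc α β, f x = c + ∫ t in x₀..x, F t) :
    IsPrimitiveOn α β f F := by
  refine ⟨hF, fun x hx y hy => ?_⟩
  rw [h x hx, h y hy, add_sub_add_left_eq_sub]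
  exact intervalIntegral.integral_interval_sub_left (intervalIntegrable_of_mem_Icc hF hx₀ hy)
    (intervalIntegrable_of_mem_Icc hF hx₀ hx)

theorem IsPrimitiveOn.eq_add (h : IsPrimitiveOn α β f F) {x y : ℝ} (hx : x ∈ Icc α β)
    (hy : y ∈ Icc α β) : f y = f x + ∫ t in x..y, F t := by
  rw [← h.sub_eq x hx y hy, add_sub_cancel]

theorem IsPrimitiveOn.congr (hαβ : α ≤ β) (h : IsPrimitiveOn α β f F)
    (hFG : F =ᵐ[volume.restrict (Ioc α β)] G) : IsPrimitiveOn α β f G := by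
  rw [EventuallyEq, ae_restrict_iff' measurableSet_Ioc] at hFG
  constructor
  · refine h.intervalIntegrable.congr_ae ?_
    rw [EventuallyEq, ae_restrict_iff' measurableSet_uIoc]
    rwa [uIoc_of_le hαβ]
  · intro x hx y hy
    rw [h.sub_eq x hx y hy]
    refine intervalIntegral.integral_congr_ae ?_
    filter_upwards [hFG] with t ht hxy
    refine ht ?_
    rcases le_total x y with e | e
    · rw [uIoc_of_le e] at hxy
      exact ⟨hx.1.trans_lt hxy.1, hxy.2.trans hy.2⟩
    · rw [uIoc_of_ge e] at hxy
      exact ⟨hy.1.trans_lt hxy.1, hxy.2.trans hx.2⟩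

theorem IsPrimitiveOn.add (hf : IsPrimitiveOn α β f F) (hg : IsPrimitiveOn α β g G) :
    IsPrimitiveOn α β (f + g) (F + G) := by
  refine ⟨hf.intervalIntegrable.add hg.intervalIntegrable, fun x hx y hy => ?_⟩
  have := intervalIntegral.integral_add
    (intervalIntegrable_of_mem_Icc hf.intervalIntegrable hx hy)
    (intervalIntegrable_of_mem_Icc hg.intervalIntegrable hx hy)
  simp only [Pi.add_apply]
  rw [this, ← hf.sub_eq x hx y hy, ← hg.sub_eq x hx y hy]
  abel

theorem IsPrimitiveOn.sub (hf : IsPrimitiveOn α β f F) (hg : IsPrimitiveOn α β g G) :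
    IsPrimitiveOn α β (f - g) (F - G) := by
  refine ⟨hf.intervalIntegrable.sub hg.intervalIntegrable, fun x hx y hy => ?_⟩
  have := intervalIntegral.integral_sub
    (intervalIntegrable_of_mem_Icc hf.intervalIntegrable hx hy)
    (intervalIntegrable_of_mem_Icc hg.intervalIntegrable hx hy)
  simp only [Pi.sub_apply]
  rw [this, ← hf.sub_eq x hx y hy, ← hg.sub_eq x hx y hy]
  abel

theorem IsPrimitiveOn.continuousOn (h : IsPrimitiveOn α β f F) : ContinuousOn f (Icc α β) := by
  rcases lt_or_ge β α with hlt | hle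
  · rw [Icc_eq_empty hlt.not_ge]
    exact continuousOn_empty f
  have hα : α ∈ Icc α β := left_mem_Icc.2 hle
  have h1 := intervalIntegral.continuousOn_primitive_interval' h.intervalIntegrable left_mem_uIcc
  rw [uIcc_of_le hle] at h1
  exact (continuousOn_const.add h1).congr fun x hx => h.eq_add hα hx

theorem IsPrimitiveOn.ae_hasDerivAt [CompleteSpace E] (h : IsPrimitiveOn α β f F) :
    ∀ᵐ x, x ∈ Ioo α β → HasDerivAt f (F x) x := by
  filter_upwards [h.intervalIntegrable.ae_hasDerivAt_integral] with x hx hxI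
  have hle : α ≤ β := (hxI.1.trans hxI.2).le
  have hα : α ∈ Icc α β := left_mem_Icc.2 hle
  have hd := (hx (by rw [uIcc_of_le hle]; exact Ioo_subset_Icc_self hxI) α
    left_mem_uIcc).const_add (f α)
  refine hd.congr_of_eventuallyEq ?_
  filter_upwards [Ioo_mem_nhds hxI.1 hxI.2] with y hy
  exact h.eq_add hα (Ioo_subset_Icc_self hy)

/-- A function whose increments are controlled by those of an absolutely continuous function is
absolutely continuous. -/
theorem absolutelyContinuousOnInterval_of_dist_le {X Y : Type*} [PseudoMetricSpace X]
    [PseudoMetricSpace Y] {φ : ℝ → X} {ψ : ℝ → Y} (hψ : AbsolutelyContinuousOnInterval ψ α β)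
    (C : ℝ) (h : ∀ x ∈ uIcc α β, ∀ y ∈ uIcc α β, dist (φ x) (φ y) ≤ C * dist (ψ x) (ψ y)) :
    AbsolutelyContinuousOnInterval φ α β := by
  have hlim := Tendsto.const_mul C hψ
  rw [mul_zero] at hlim
  refine squeeze_zero' (Eventually.of_forall fun E => Finset.sum_nonneg fun _ _ => dist_nonneg) ?_
    hlim
  filter_upwards [mem_inf_of_right (mem_principal_self _)] with I hI
  rw [Finset.mul_sum]
  exact Finset.sum_le_sum fun i hi => h _ (hI.1 i hi).1 _ (hI.1 i hi).2

theorem IsPrimitiveOn.dist_le (h : IsPrimitiveOn α β f F) {x y : ℝ} (hx : x ∈ Icc α β)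
    (hy : y ∈ Icc α β) : dist (f x) (f y) ≤ |∫ t in x..y, ‖F t‖| := by
  rw [dist_comm, dist_eq_norm, h.sub_eq x hx y hy]
  exact intervalIntegral.norm_integral_le_abs_integral_norm

/-- Integration by parts: the sesquilinear pairing of two absolutely continuous functions is
absolutely continuous and obeys the product rule. -/
theorem IsPrimitiveOn.innerProduct {H : Type*} [NormedAddCommGroup H] [InnerProductSpace ℂ H]
    [CompleteSpace H] {f g F G : ℝ → H} (hαβ : α ≤ β) (hf : IsPrimitiveOn α β f F)
    (hg : IsPrimitiveOn α β g G) :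
    IsPrimitiveOn α β (fun x => inner ℂ (f x) (g x))
      (fun x => inner ℂ (F x) (g x) + inner ℂ (f x) (G x)) := by
  have hu : uIcc α β = Icc α β := uIcc_of_le hαβ
  obtain ⟨M, hM⟩ := isCompact_Icc.exists_bound_of_continuousOn hf.continuousOn
  obtain ⟨N, hN⟩ := isCompact_Icc.exists_bound_of_continuousOn hg.continuousOn
  have hM0 : 0 ≤ M := (norm_nonneg _).trans (hM α (left_mem_Icc.2 hαβ))
  have hN0 : 0 ≤ N := (norm_nonneg _).trans (hN α (left_mem_Icc.2 hαβ))
  have hFi := (intervalIntegrable_iff_integrableOn_Ioc_of_le hαβ).1 hf.intervalIntegrable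
  have hGi := (intervalIntegrable_iff_integrableOn_Ioc_of_le hαβ).1 hg.intervalIntegrable
  have hfm : AEStronglyMeasurable f (volume.restrict (Ioc α β)) :=
    (hf.continuousOn.aestronglyMeasurable measurableSet_Icc).mono_measure
      (Measure.restrict_mono Ioc_subset_Icc_self le_rfl)
  have hgm : AEStronglyMeasurable g (volume.restrict (Ioc α β)) :=
    (hg.continuousOn.aestronglyMeasurable measurableSet_Icc).mono_measure
      (Measure.restrict_mono Ioc_subset_Icc_self le_rfl)
  have hi : IntervalIntegrable
      (fun x => inner ℂ (F x) (g x) + inner ℂ (f x) (G x)) volume α β := by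
    rw [intervalIntegrable_iff_integrableOn_Ioc_of_le hαβ]
    refine Integrable.add ?_ ?_
    · refine (hFi.norm.mul_const N).mono' (hFi.aestronglyMeasurable.inner hgm) ?_
      filter_upwards [ae_restrict_mem measurableSet_Ioc] with x hx
      exact (norm_inner_le_norm _ _).trans
        (mul_le_mul_of_nonneg_left (hN x (Ioc_subset_Icc_self hx)) (norm_nonneg _))
    · refine (hGi.norm.const_mul M).mono' (hfm.inner hGi.aestronglyMeasurable) ?_
      filter_upwards [ae_restrict_mem measurableSet_Ioc] with x hx
      exact (norm_inner_le_norm _ _).trans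
        (mul_le_mul_of_nonneg_right (hM x (Ioc_subset_Icc_self hx)) (norm_nonneg _))
  refine isPrimitiveOn_of_base (x₀ := α) (c := inner ℂ (f α) (g α)) (left_mem_Icc.2 hαβ) hi ?_
  set J : ℝ → ℂ := fun x => inner ℂ (F x) (g x) + inner ℂ (f x) (G x) with hJ
  -- `ρ` is a real absolutely continuous function that dominates all increments.
  set ρ : ℝ → ℝ := fun x => ∫ t in α..x, (‖F t‖ + ‖G t‖ + ‖J t‖) with hρ
  have hρi : IntervalIntegrable (fun t => ‖F t‖ + ‖G t‖ + ‖J t‖) volume α β :=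
    (hf.intervalIntegrable.norm.add hg.intervalIntegrable.norm).add hi.norm
  have hρac : AbsolutelyContinuousOnInterval ρ α β :=
    hρi.absolutelyContinuousOnInterval_intervalIntegral left_mem_uIcc
  have hρd : ∀ x ∈ Icc α β, ∀ y ∈ Icc α β,
      dist (ρ x) (ρ y) = |∫ t in x..y, ‖F t‖| + |∫ t in x..y, ‖G t‖| + |∫ t in x..y, ‖J t‖| := by
    intro x hx y hy
    wlog hxy : x ≤ y generalizing x y
    · rw [dist_comm, this y hy x hx (le_of_not_ge hxy), intervalIntegral.integral_symm x y,
        intervalIntegral.integral_symm x y, intervalIntegral.integral_symm x y]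
      simp only [abs_neg]
    have i1 := intervalIntegrable_of_mem_Icc hf.intervalIntegrable.norm hx hy
    have i2 := intervalIntegrable_of_mem_Icc hg.intervalIntegrable.norm hx hy
    have i3 := intervalIntegrable_of_mem_Icc hi.norm hx hy
    rw [dist_comm, Real.dist_eq, hρ, intervalIntegral.integral_interval_sub_left
      (intervalIntegrable_of_mem_Icc hρi (left_mem_Icc.2 hαβ) hy)
      (intervalIntegrable_of_mem_Icc hρi (left_mem_Icc.2 hαβ) hx),
      intervalIntegral.integral_add (i1.add i2) i3, intervalIntegral.integral_add i1 i2]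
    have p : ∀ k : ℝ → ℝ, (∀ t, 0 ≤ k t) → 0 ≤ ∫ t in x..y, k t := fun k hk =>
      intervalIntegral.integral_nonneg hxy fun t _ => hk t
    rw [abs_of_nonneg (p _ fun t => norm_nonneg _), abs_of_nonneg (p _ fun t => norm_nonneg _),
      abs_of_nonneg (p _ fun t => norm_nonneg _), abs_of_nonneg]
    exact add_nonneg (add_nonneg (p _ fun t => norm_nonneg _) (p _ fun t => norm_nonneg _))
      (p _ fun t => norm_nonneg _)
  set φ : ℝ → ℂ := fun x => inner ℂ (f x) (g x) - ∫ t in α..x, J t with hφ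
  have hφac : AbsolutelyContinuousOnInterval φ α β := by
    refine absolutelyContinuousOnInterval_of_dist_le hρac (M + N + 1) ?_
    rw [hu]
    intro x hx y hy
    rw [hρd x hx y hy]
    have e1 : φ x - φ y = inner ℂ (f x) (g x - g y) + inner ℂ (f x - f y) (g y)
        + ∫ t in x..y, J t := by
      rw [← intervalIntegral.integral_interval_sub_left
        (intervalIntegrable_of_mem_Icc hi (left_mem_Icc.2 hαβ) hy)
        (intervalIntegrable_of_mem_Icc hi (left_mem_Icc.2 hαβ) hx), hφ, inner_sub_right,
        inner_sub_left]
      ring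
    have d1 := hf.dist_le hx hy
    have d2 := hg.dist_le hx hy
    have d3 : ‖∫ t in x..y, J t‖ ≤ |∫ t in x..y, ‖J t‖| :=
      intervalIntegral.norm_integral_le_abs_integral_norm
    rw [dist_eq_norm] at d1 d2
    rw [dist_eq_norm, e1]
    have n1 : ‖inner ℂ (f x) (g x - g y)‖ ≤ M * |∫ t in x..y, ‖G t‖| :=
      (norm_inner_le_norm _ _).trans (mul_le_mul (hM x hx) d2 (norm_nonneg _) hM0)
    have n2 : ‖inner ℂ (f x - f y) (g y)‖ ≤ |∫ t in x..y, ‖F t‖| * N :=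
      (norm_inner_le_norm _ _).trans (mul_le_mul d1 (hN y hy) (norm_nonneg _) (abs_nonneg _))
    refine (norm_add₃_le).trans ?_
    have a1 := abs_nonneg (∫ t in x..y, ‖F t‖)
    have a2 := abs_nonneg (∫ t in x..y, ‖G t‖)
    have a3 := abs_nonneg (∫ t in x..y, ‖J t‖)
    nlinarith [mul_nonneg hM0 a1, mul_nonneg hM0 a3, mul_nonneg hN0 a2, mul_nonneg hN0 a3]
  have hφd : ∀ᵐ x, x ∈ uIcc α β → HasDerivAt φ 0 x := by
    have hne : ∀ᵐ x : ℝ, x ≠ α ∧ x ≠ β :=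
      (Measure.ae_ne volume α).and (Measure.ae_ne volume β)
    filter_upwards [hf.ae_hasDerivAt, hg.ae_hasDerivAt, hi.ae_hasDerivAt_integral, hne]
      with x h1 h2 h3 h4 hx
    have hx' := hx
    rw [hu] at hx'
    have hxo : x ∈ Ioo α β := ⟨lt_of_le_of_ne hx'.1 h4.1.symm, lt_of_le_of_ne hx'.2 h4.2⟩
    have := ((h1 hxo).inner ℂ (h2 hxo)).sub (h3 hx α left_mem_uIcc)
    refine this.congr_deriv ?_
    simp only [hJ]
    ring
  obtain ⟨C, hC⟩ := hφac.const_of_ae_hasDerivAt_zero hφd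
  intro x hx
  have e1 := hC x (hu ▸ hx)
  have e2 := hC α left_mem_uIcc
  simp only [hφ, intervalIntegral.integral_same, sub_zero] at e1 e2
  rw [e2, ← e1]
  ring

end primitive

/-! ### Measurability -/

section measurability

variable {H : Type*} [NormedAddCommGroup H] [InnerProductSpace ℂ H] [CompleteSpace H]
  [TopologicalSpace.SeparableSpace H]

omit [CompleteSpace H] in
theorem _root_.Orthonormal.countable_of_separableSpace {w : Set H}
    (hw : Orthonormal ℂ ((↑) : w → H)) : w.Countable := by
  refine Set.PairwiseDisjoint.countable_of_isOpen (s := fun x => Metric.ball x (1 / 2))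
    (fun x hx y hy hxy => ?_) (fun x _ => Metric.isOpen_ball)
    (fun x _ => ⟨x, Metric.mem_ball_self (by norm_num)⟩)
  refine Metric.ball_disjoint_ball ?_
  have h0 : inner ℂ x y = 0 := hw.2 (i := ⟨x, hx⟩) (j := ⟨y, hy⟩) (by simpa using hxy)
  have h1 : ‖x‖ = 1 := hw.1 ⟨x, hx⟩
  have h2 : ‖y‖ = 1 := hw.1 ⟨y, hy⟩
  have h3 := norm_sub_sq (𝕜 := ℂ) x y
  rw [h0, h1, h2] at h3
  rw [dist_eq_norm]
  norm_num at h3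
  nlinarith [norm_nonneg (x - y)]

/-- Pettis' theorem in a separable Hilbert space: weak measurability implies strong
measurability, because a function is the sum of its expansion in a countable Hilbert basis. -/
theorem aestronglyMeasurable_of_inner {X : Type*} [MeasurableSpace X] {μ : Measure X}
    {u : X → H} (h : ∀ e : H, AEStronglyMeasurable (fun x => inner ℂ e (u x)) μ) :
    AEStronglyMeasurable u μ := by
  obtain ⟨w, b, hb⟩ := exists_hilbertBasis ℂ H
  have : Countable w := by
    refine (Orthonormal.countable_of_separableSpace (w := w) ?_).to_subtype
    rw [← hb]
    exact b.orthonormal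
  refine aestronglyMeasurable_of_tendsto_ae (atTop : Filter (Finset w))
    (f := fun s x => ∑ i ∈ s, (inner ℂ (b i) (u x)) • b i) (fun s => ?_)
    (Eventually.of_forall fun x => ?_)
  · exact Finset.aestronglyMeasurable_fun_sum s fun i _ => (h (b i)).smul_const (b i)
  · have := b.hasSum_repr (u x)
    simp only [b.repr_apply_apply] at this
    exact this

variable {a b : EReal} {V : ℝ → H →L[ℂ] H}

theorem IsPotential.aestronglyMeasurable_apply (hV : IsPotential a b V) {y : ℝ → H} {s : Set ℝ}
    (hs : s ⊆ interval a b) (hy : AEStronglyMeasurable y (volume.restrict s)) :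
    AEStronglyMeasurable (fun x => V x (y x)) (volume.restrict s) := by
  have hle : volume.restrict s ≤ vol a b := Measure.restrict_mono hs le_rfl
  have hconst : ∀ e : H, AEStronglyMeasurable (fun x => V x e) (volume.restrict s) := fun e =>
    aestronglyMeasurable_of_inner fun f =>
      ((hV.weaklyMeasurable f e).mono_measure hle).aestronglyMeasurable
  -- Self-adjointness moves `V x` to the constant vector `e`: `⟪e, V x (y x)⟫ = ⟪V x e, y x⟫`.
  refine aestronglyMeasurable_of_inner fun e => ((hconst e).inner (𝕜 := ℂ) hy).congr ?_
  filter_upwards [ae_mono hle hV.selfAdjoint] with x hx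
  rw [← ContinuousLinearMap.adjoint_inner_right, hx.adjoint_eq]

theorem Icc_subset_interval {α β : ℝ} (hα : α ∈ interval a b) (hβ : β ∈ interval a b) :
    Icc α β ⊆ interval a b := (ordConnected_interval a b).out hα hβ

omit [TopologicalSpace.SeparableSpace H] in
theorem IsPotential.intervalIntegrable_norm (hV : IsPotential a b V) {α β : ℝ}
    (hα : α ∈ interval a b) (hβ : β ∈ interval a b) :
    IntervalIntegrable (fun x => ‖V x‖) volume α β :=
  intervalIntegrable_iff.2 <|
    (hV.locInt_norm.integrableOn_compact_subset
      ((ordConnected_interval a b).uIcc_subset hα hβ) isCompact_uIcc).mono_set uIoc_subset_uIcc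

theorem IsPotential.intervalIntegrable_apply (hV : IsPotential a b V) {α β : ℝ}
    (hα : α ∈ interval a b) (hβ : β ∈ interval a b) (hαβ : α ≤ β) {y : ℝ → H}
    (hy : ContinuousOn y (Icc α β)) : IntervalIntegrable (fun x => V x (y x)) volume α β := by
  have hs := Icc_subset_interval hα hβ
  obtain ⟨M, hM⟩ := isCompact_Icc.exists_bound_of_continuousOn hy
  have hVi := (intervalIntegrable_iff_integrableOn_Ioc_of_le hαβ).1
    (hV.intervalIntegrable_norm hα hβ)
  rw [intervalIntegrable_iff_integrableOn_Ioc_of_le hαβ]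
  refine (hVi.mul_const M).mono' (hV.aestronglyMeasurable_apply (Ioc_subset_Icc_self.trans hs)
    ((hy.aestronglyMeasurable measurableSet_Icc).mono_measure
      (Measure.restrict_mono Ioc_subset_Icc_self le_rfl))) ?_
  filter_upwards [ae_restrict_mem measurableSet_Ioc] with x hx
  exact ((V x).le_opNorm _).trans
    (mul_le_mul_of_nonneg_left (hM x (Ioc_subset_Icc_self hx)) (norm_nonneg _))

end measurability

/-! ### Lagrange's identity -/

/-- Lagrange's identity: if `-f'' + V f = h` and `-g'' + V g = k` then
`⟪f, k⟫ - ⟪h, g⟫` is the derivative of the Wronskian `⟪f', g⟫ - ⟪f, g'⟫`. -/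
theorem IsPotential.lagrange {H : Type*} [NormedAddCommGroup H] [InnerProductSpace ℂ H]
    [CompleteSpace H] {a b : EReal} {V : ℝ → H →L[ℂ] H} (hV : IsPotential a b V) {α β : ℝ}
    (hα : α ∈ interval a b) (hβ : β ∈ interval a b) (hαβ : α ≤ β) {f f₁ g g₁ h k : ℝ → H}
    (hf : IsPrimitiveOn α β f f₁) (hf₁ : IsPrimitiveOn α β f₁ (fun x => V x (f x) - h x))
    (hg : IsPrimitiveOn α β g g₁) (hg₁ : IsPrimitiveOn α β g₁ (fun x => V x (g x) - k x)) :
    ∫ x in α..β, (inner ℂ (f x) (k x) - inner ℂ (h x) (g x)) =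
      (inner ℂ (f₁ β) (g β) - inner ℂ (f β) (g₁ β)) -
        (inner ℂ (f₁ α) (g α) - inner ℂ (f α) (g₁ α)) := by
  have key := ((hf₁.innerProduct hαβ hg).sub (hf.innerProduct hαβ hg₁)).sub_eq α (left_mem_Icc.2 hαβ) β
    (right_mem_Icc.2 hαβ)
  simp only [Pi.sub_apply] at key
  rw [key]
  refine intervalIntegral.integral_congr_ae ?_
  have hsa := hV.selfAdjoint
  rw [ae_restrict_iff' (measurableSet_interval a b)] at hsa
  filter_upwards [hsa] with x hx hxm
  rw [uIoc_of_le hαβ] at hxm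
  have hs := hx (Icc_subset_interval hα hβ (Ioc_subset_Icc_self hxm))
  have e : inner ℂ (V x (f x)) (g x) = inner ℂ (f x) (V x (g x)) := by
    rw [← ContinuousLinearMap.adjoint_inner_right, hs.adjoint_eq]
  rw [inner_sub_left, inner_sub_right, e]
  ring

/-! ### Strong derivatives on the whole interval -/

section global

variable {a b : EReal}

theorem interval_nonempty (hab : a < b) : (interval a b).Nonempty := by
  obtain ⟨x, h1, h2⟩ := EReal.lt_iff_exists_real_btwn.1 hab
  exact ⟨x, h1, h2⟩

theorem exists_Ioo_interval {x : ℝ} (hx : x ∈ interval a b) :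
    ∃ α ∈ interval a b, ∃ β ∈ interval a b, α < x ∧ x < β := by
  obtain ⟨α, h1, h2⟩ := EReal.lt_iff_exists_real_btwn.1 hx.1
  obtain ⟨β, h3, h4⟩ := EReal.lt_iff_exists_real_btwn.1 hx.2
  rw [EReal.coe_lt_coe_iff] at h2 h3
  exact ⟨α, ⟨h1, (EReal.coe_lt_coe_iff.2 h2).trans hx.2⟩, β,
    ⟨hx.1.trans (EReal.coe_lt_coe_iff.2 h3), h4⟩, h2, h3⟩

/-- Every compact subset of `(a, b)` lies in some `(α, β)` with `α, β ∈ (a, b)`. -/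
theorem exists_Ioo_of_isCompact (hab : a < b) {K : Set ℝ} (hK : IsCompact K)
    (hKI : K ⊆ interval a b) :
    ∃ α ∈ interval a b, ∃ β ∈ interval a b, α < β ∧ K ⊆ Ioo α β := by
  rcases K.eq_empty_or_nonempty with rfl | hne
  · obtain ⟨x, h1, h2⟩ := EReal.lt_iff_exists_real_btwn.1 hab
    obtain ⟨α, hα, β, hβ, h3, h4⟩ := exists_Ioo_interval (x := x) ⟨h1, h2⟩
    exact ⟨α, hα, β, hβ, h3.trans h4, empty_subset _⟩
  · obtain ⟨α, hα, -, -, h1, -⟩ := exists_Ioo_interval (hKI (hK.sInf_mem hne))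
    obtain ⟨-, -, β, hβ, -, h2⟩ := exists_Ioo_interval (hKI (hK.sSup_mem hne))
    have hsub : K ⊆ Ioo α β := fun x hx =>
      ⟨h1.trans_le (csInf_le hK.bddBelow hx), (le_csSup hK.bddAbove hx).trans_lt h2⟩
    obtain ⟨x, hx⟩ := hne
    exact ⟨α, hα, β, hβ, (hsub hx).1.trans (hsub hx).2, hsub⟩

theorem locallyIntegrableOn_interval {E : Type*} [NormedAddCommGroup E] (hab : a < b)
    {F : ℝ → E}
    (h : ∀ α ∈ interval a b, ∀ β ∈ interval a b, α ≤ β → IntervalIntegrable F volume α β) :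
    LocallyIntegrableOn F (interval a b) volume := by
  rw [locallyIntegrableOn_iff (isOpen_interval a b).isLocallyClosed]
  intro K hKI hK
  obtain ⟨α, hα, β, hβ, hlt, hsub⟩ := exists_Ioo_of_isCompact hab hK hKI
  exact ((intervalIntegrable_iff_integrableOn_Ioc_of_le hlt.le).1 (h α hα β hβ hlt.le)).mono_set
    (hsub.trans Ioo_subset_Ioc_self)

theorem restrict_Ioc_le_vol {α β : ℝ} (hα : α ∈ interval a b) (hβ : β ∈ interval a b) :
    volume.restrict (Ioc α β) ≤ vol a b :=
  Measure.restrict_mono (Ioc_subset_Icc_self.trans ((ordConnected_interval a b).out hα hβ)) le_rfl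

/-- A property that holds almost everywhere near each point of `(a, b)` holds almost everywhere. -/
theorem ae_vol_of_locally {p : ℝ → Prop}
    (h : ∀ x ∈ interval a b, ∃ α β, α < x ∧ x < β ∧ ∀ᵐ t ∂(volume.restrict (Ioc α β)), p t) :
    ∀ᵐ t ∂(vol a b), p t := by
  rw [ae_restrict_iff' (measurableSet_interval a b), ae_iff]
  refine measure_null_of_locally_null _ fun x hx => ?_
  obtain ⟨hxI, -⟩ : x ∈ interval a b ∧ ¬ p x := by simpa using hx
  obtain ⟨α, β, h1, h2, h3⟩ := h x hxI
  rw [ae_restrict_iff' measurableSet_Ioc, ae_iff] at h3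
  refine ⟨Ioo α β ∩ _, inter_mem (mem_nhdsWithin_of_mem_nhds (Ioo_mem_nhds h1 h2))
    self_mem_nhdsWithin, measure_mono_null ?_ h3⟩
  rintro t ⟨ht, ht'⟩ hcon
  exact ht' fun _ => hcon (Ioo_subset_Ioc_self ht)

variable {H : Type*} [NormedAddCommGroup H] [InnerProductSpace ℂ H]

/-- A strongly locally absolutely continuous function has a representative that is absolutely
continuous on every compact subinterval. -/
theorem HasStrongDeriv.exists_representative {f F : ℝ → H} (h : HasStrongDeriv a b f F) :
    ∃ y : ℝ → H, f =ᵐ[vol a b] y ∧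
      ∀ α ∈ interval a b, ∀ β ∈ interval a b, α ≤ β → IsPrimitiveOn α β y F := by
  obtain ⟨x₀, hx₀, c, hc⟩ := h.primitive
  refine ⟨fun x => c + ∫ t in x₀..x, F t, hc, fun α hα β hβ hαβ =>
    ⟨h.intervalIntegrable hα hβ, fun x hx y hy => ?_⟩⟩
  have hs := (ordConnected_interval a b).out hα hβ
  simp only [add_sub_add_left_eq_sub]
  exact intervalIntegral.integral_interval_sub_left (h.intervalIntegrable hx₀ (hs hy))
    (h.intervalIntegrable hx₀ (hs hx))

theorem continuousOn_interval_of_isPrimitiveOn {f F : ℝ → H}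
    (h : ∀ α ∈ interval a b, ∀ β ∈ interval a b, α ≤ β → IsPrimitiveOn α β f F) :
    ContinuousOn f (interval a b) := by
  intro x hx
  obtain ⟨α, hα, β, hβ, h1, h2⟩ := exists_Ioo_interval hx
  exact ((h α hα β hβ (h1.trans h2).le).continuousOn.continuousAt
    (Icc_mem_nhds h1 h2)).continuousWithinAt

theorem hasStrongDeriv_of_isPrimitiveOn (hab : a < b) {f y F : ℝ → H} (hf : f =ᵐ[vol a b] y)
    (h : ∀ α ∈ interval a b, ∀ β ∈ interval a b, α ≤ β → IsPrimitiveOn α β y F) :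
    HasStrongDeriv a b f F := by
  refine HasStrongDeriv.congr ⟨?_, ?_, ?_⟩ hf.symm
  · exact (continuousOn_interval_of_isPrimitiveOn h).locallyIntegrableOn
      (measurableSet_interval a b)
  · exact locallyIntegrableOn_interval hab fun α hα β hβ hαβ => (h α hα β hβ hαβ).intervalIntegrable
  · obtain ⟨x₀, h1, h2⟩ := EReal.lt_iff_exists_real_btwn.1 hab
    have hx₀ : x₀ ∈ interval a b := ⟨h1, h2⟩
    refine ⟨x₀, hx₀, y x₀, ?_⟩
    filter_upwards [ae_restrict_mem (measurableSet_interval a b)] with x hx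
    rcases le_total x₀ x with e | e
    · exact (h x₀ hx₀ x hx e).eq_add (left_mem_Icc.2 e) (right_mem_Icc.2 e)
    · exact (h x hx x₀ hx₀ e).eq_add (right_mem_Icc.2 e) (left_mem_Icc.2 e)

theorem HasStrongDeriv.congr_deriv {f F G : ℝ → H} (h : HasStrongDeriv a b f F)
    (hFG : F =ᵐ[vol a b] G) : HasStrongDeriv a b f G := by
  obtain ⟨x₀, hx₀, c, hc⟩ := h.primitive
  refine ⟨h.locInt, h.locInt_deriv.congr hFG, x₀, hx₀, c, ?_⟩
  filter_upwards [hc, ae_restrict_mem (measurableSet_interval a b)] with x hx hxI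
  rw [hx]
  congr 1
  refine intervalIntegral.integral_congr_ae ?_
  rw [EventuallyEq, ae_restrict_iff' (measurableSet_interval a b)] at hFG
  filter_upwards [hFG] with t ht htm
  exact ht ((ordConnected_interval a b).uIcc_subset hx₀ hxI (uIoc_subset_uIcc htm))

theorem HasStrongDeriv.restrict {f F : ℝ → H} (h : HasStrongDeriv a b f F) {a' b' : EReal}
    (hab' : a' < b') (hsub : interval a' b' ⊆ interval a b) : HasStrongDeriv a' b' f F := by
  obtain ⟨y, hy, hp⟩ := h.exists_representative
  exact hasStrongDeriv_of_isPrimitiveOn hab'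
    (ae_mono (Measure.restrict_mono hsub le_rfl) hy)
    fun α hα β hβ hαβ => hp α (hsub hα) β (hsub hβ) hαβ

/-- A function `f ∈ W^{2,1}_loc` and its derivative have representatives that are absolutely
continuous on compact subintervals, with second derivative `V f - τ f`. -/
theorem MemW21loc.exists_representatives [CompleteSpace H] {V : ℝ → H →L[ℂ] H} {f : ℝ → H}
    (hf : MemW21loc a b f) :
    ∃ y y₁ : ℝ → H, f =ᵐ[vol a b] y ∧ strongDeriv a b f =ᵐ[vol a b] y₁ ∧
      ∀ α ∈ interval a b, ∀ β ∈ interval a b, α ≤ β →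
        IsPrimitiveOn α β y y₁ ∧ IsPrimitiveOn α β y₁ (fun x => V x (y x) - tau a b V f x) := by
  obtain ⟨y, hy, hp⟩ := (hasStrongDeriv_strongDeriv hf.1).exists_representative
  obtain ⟨y₁, hy₁, hp₁⟩ := (hasStrongDeriv_strongDeriv hf.2).exists_representative
  refine ⟨y, y₁, hy, hy₁, fun α hα β hβ hαβ =>
    ⟨(hp α hα β hβ hαβ).congr hαβ (ae_mono (restrict_Ioc_le_vol hα hβ) hy₁),
      (hp₁ α hα β hβ hαβ).congr hαβ ?_⟩⟩
  filter_upwards [ae_mono (restrict_Ioc_le_vol hα hβ) hy] with x hx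
  simp only [tau, hx]
  abel

/-- On a connected interval, functions that are locally affine (up to null sets) are affine. -/
theorem exists_affine_of_locally (hab : a < b) {f : ℝ → H}
    (h : ∀ x ∈ interval a b, ∃ α β, α < x ∧ x < β ∧
      ∃ c d : H, ∀ᵐ t ∂(volume.restrict (Ioc α β)), f t = c + t • d) :
    ∃ c d : H, ∀ᵐ t ∂(vol a b), f t = c + t • d := by
  choose! A B hA hB C D hCD using h
  -- Two affine functions that agree almost everywhere on an overlap agree.
  have hloc : ∀ x ∈ interval a b, ∀ᶠ y in 𝓝[interval a b] x, C x = C y ∧ D x = D y := by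
    intro x hx
    filter_upwards [mem_nhdsWithin_of_mem_nhds (Ioo_mem_nhds (hA x hx) (hB x hx)),
      self_mem_nhdsWithin] with y hy hyI
    set U : Set ℝ := Ioo (max (A x) (A y)) (min (B x) (B y)) with hU
    have hUx : U ⊆ Ioc (A x) (B x) := fun t ht =>
      ⟨(le_max_left _ _).trans_lt ht.1, ht.2.le.trans (min_le_left _ _)⟩
    have hUy : U ⊆ Ioc (A y) (B y) := fun t ht =>
      ⟨(le_max_right _ _).trans_lt ht.1, ht.2.le.trans (min_le_right _ _)⟩
    have hae : (fun t : ℝ => C x + t • D x) =ᵐ[volume.restrict U] fun t => C y + t • D y := by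
      filter_upwards [ae_restrict_of_ae_restrict_of_subset hUx (hCD x hx),
        ae_restrict_of_ae_restrict_of_subset hUy (hCD y hyI)] with t h1 h2
      rw [← h1, h2]
    have heq := Measure.eqOn_open_of_ae_eq hae isOpen_Ioo
      (by fun_prop) (by fun_prop)
    have hyU : y ∈ U := ⟨max_lt hy.1 (hA y hyI), lt_min hy.2 (hB y hyI)⟩
    obtain ⟨z, hz1, hz2⟩ := exists_between hyU.2
    have e1 : C x + y • D x = C y + y • D y := heq hyU
    have e2 : C x + z • D x = C y + z • D y := heq ⟨hyU.1.trans hz1, hz2⟩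
    have e3 : (z - y) • (D x - D y) = 0 := by
      have : (z - y) • (D x - D y) =
        (C x + z • D x) - (C y + z • D y) - ((C x + y • D x) - (C y + y • D y)) := by
        module
      rw [this, e1, e2]
      simp
    have e4 : D x = D y :=
      sub_eq_zero.1 ((smul_eq_zero.1 e3).resolve_left (sub_ne_zero.2 hz1.ne'))
    rw [e4] at e1
    exact ⟨add_right_cancel e1, e4⟩
  obtain ⟨x₀, h1, h2⟩ := EReal.lt_iff_exists_real_btwn.1 hab
  refine ⟨C x₀, D x₀, ae_vol_of_locally fun x hx => ⟨A x, B x, hA x hx, hB x hx, ?_⟩⟩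
  have hconst := (ordConnected_interval a b).isPreconnected.induction₂
    (fun x y => C x = C y ∧ D x = D y) hloc
    (fun x y z _ _ _ p q => ⟨p.1.trans q.1, p.2.trans q.2⟩)
    (fun x y _ _ p => ⟨p.1.symm, p.2.symm⟩) (show x₀ ∈ interval a b from ⟨h1, h2⟩) hx
  rw [hconst.1, hconst.2]
  exact hCD x hx

/-- Solutions of `f'' = q` can be glued: if near each point `f` is almost everywhere equal to a
function with second derivative `q`, then `f` has the second strong derivative `q` on `(a, b)`. -/
theorem exists_hasStrongDeriv_of_locally [CompleteSpace H] (hab : a < b) {f q : ℝ → H}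
    (h : ∀ x ∈ interval a b, ∃ α ∈ interval a b, ∃ β ∈ interval a b, α < x ∧ x < β ∧
      ∃ y y₁ : ℝ → H, f =ᵐ[volume.restrict (Ioc α β)] y ∧
        IsPrimitiveOn α β y y₁ ∧ IsPrimitiveOn α β y₁ q) :
    ∃ f₁, HasStrongDeriv a b f f₁ ∧ HasStrongDeriv a b f₁ q := by
  have hq : LocallyIntegrableOn q (interval a b) volume := by
    intro x hx
    obtain ⟨α, -, β, -, h1, h2, y, y₁, -, -, h3⟩ := h x hx
    refine ⟨Ioo α β, mem_nhdsWithin_of_mem_nhds (Ioo_mem_nhds h1 h2), ?_⟩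
    exact ((intervalIntegrable_iff_integrableOn_Ioc_of_le (h1.trans h2).le).1
      h3.intervalIntegrable).mono_set Ioo_subset_Ioc_self
  have hqi : ∀ α ∈ interval a b, ∀ β ∈ interval a b, IntervalIntegrable q volume α β :=
    fun α hα β hβ => intervalIntegrable_iff.2 <| (hq.integrableOn_compact_subset
      ((ordConnected_interval a b).uIcc_subset hα hβ) isCompact_uIcc).mono_set uIoc_subset_uIcc
  obtain ⟨x₀, hx₀⟩ := interval_nonempty hab
  -- `P` is one global function with second derivative `q`; `f - P` is locally affine.
  set P₁ : ℝ → H := fun x => ∫ t in x₀..x, q t with hP₁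
  have hP₁p : ∀ α ∈ interval a b, ∀ β ∈ interval a b, α ≤ β → IsPrimitiveOn α β P₁ q := by
    intro α hα β hβ hαβ
    refine ⟨hqi α hα β hβ, fun x hx y hy => ?_⟩
    have hs := (ordConnected_interval a b).out hα hβ
    exact intervalIntegral.integral_interval_sub_left (hqi _ hx₀ _ (hs hy)) (hqi _ hx₀ _ (hs hx))
  have hP₁c : ContinuousOn P₁ (interval a b) := continuousOn_interval_of_isPrimitiveOn hP₁p
  have hP₁i : ∀ α ∈ interval a b, ∀ β ∈ interval a b, IntervalIntegrable P₁ volume α β :=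
    fun α hα β hβ => (hP₁c.mono
      ((ordConnected_interval a b).uIcc_subset hα hβ)).intervalIntegrable
  set P : ℝ → H := fun x => ∫ t in x₀..x, P₁ t with hP
  have hPp : ∀ α ∈ interval a b, ∀ β ∈ interval a b, α ≤ β → IsPrimitiveOn α β P P₁ := by
    intro α hα β hβ hαβ
    refine ⟨hP₁i α hα β hβ, fun x hx y hy => ?_⟩
    have hs := (ordConnected_interval a b).out hα hβ
    exact intervalIntegral.integral_interval_sub_left (hP₁i _ hx₀ _ (hs hy))
      (hP₁i _ hx₀ _ (hs hx))
  obtain ⟨c, d, hcd⟩ : ∃ c d : H, ∀ᵐ t ∂(vol a b), f t - P t = c + t • d := by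
    refine exists_affine_of_locally hab fun x hx => ?_
    obtain ⟨α, hα, β, hβ, h1, h2, y, y₁, h3, h4, h5⟩ := h x hx
    have hle := (h1.trans h2).le
    have hαm : α ∈ Icc α β := left_mem_Icc.2 hle
    have hD₁ := h5.sub (hP₁p α hα β hβ hle)
    have hD := h4.sub (hPp α hα β hβ hle)
    have e1 : ∀ t ∈ Icc α β, (y₁ - P₁) t = (y₁ - P₁) α := fun t ht => by
      rw [hD₁.eq_add hαm ht, sub_self]
      simp
    have e2 : ∀ t ∈ Icc α β, (y - P) t = (y - P) α + (t - α) • (y₁ - P₁) α := fun t ht => by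
      rw [hD.eq_add hαm ht, intervalIntegral.integral_congr (g := fun _ => (y₁ - P₁) α),
        intervalIntegral.integral_const]
      intro s hs
      rw [uIcc_of_le ht.1] at hs
      exact e1 s ⟨hs.1, hs.2.trans ht.2⟩
    refine ⟨α, β, h1, h2, (y - P) α - α • (y₁ - P₁) α, (y₁ - P₁) α, ?_⟩
    filter_upwards [h3, ae_restrict_mem measurableSet_Ioc] with t ht htm
    have := e2 t (Ioc_subset_Icc_self htm)
    rw [ht, ← Pi.sub_apply, this]
    module
  refine ⟨fun x => P₁ x + d, ?_, ?_⟩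
  · refine hasStrongDeriv_of_isPrimitiveOn hab (y := fun t => P t + (c + t • d)) ?_ ?_
    · filter_upwards [hcd] with t ht
      rw [← ht, add_sub_cancel]
    · intro α hα β hβ hαβ
      refine (hPp α hα β hβ hαβ).add (G := fun _ => d)
        ⟨intervalIntegrable_const, fun x _ y _ => ?_⟩
      rw [intervalIntegral.integral_const]
      module
  · refine hasStrongDeriv_of_isPrimitiveOn hab (EventuallyEq.refl _ _) ?_
    intro α hα β hβ hαβ
    refine ⟨hqi α hα β hβ, fun x hx y hy => ?_⟩
    rw [← (hP₁p α hα β hβ hαβ).sub_eq x hx y hy]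
    abel

/-- A function with vanishing Cauchy data at both ends of `[α, β]` remains absolutely continuous
after extension by zero to `(a, b)`. -/
theorem hasStrongDeriv_indicator {α β : ℝ} (hα : α ∈ interval a b) (hαβ : α ≤ β) {g G : ℝ → H} (h : IsPrimitiveOn α β g G)
    (h0 : g α = 0) (h1 : g β = 0) :
    HasStrongDeriv a b ((Ioc α β).indicator g) ((Ioc α β).indicator G) := by
  have hi : Integrable ((Ioc α β).indicator G) volume :=
    (integrable_indicator_iff measurableSet_Ioc).2
      ((intervalIntegrable_iff_integrableOn_Ioc_of_le hαβ).1 h.intervalIntegrable)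
  refine ⟨?_, hi.locallyIntegrable.locallyIntegrableOn _, α, hα, 0, Eventually.of_forall
    fun x => ?_⟩
  · refine (Integrable.locallyIntegrable ?_).locallyIntegrableOn _
    rw [integrable_indicator_iff measurableSet_Ioc]
    exact (h.continuousOn.integrableOn_Icc).mono_set Ioc_subset_Icc_self
  rw [zero_add]
  by_cases hx : x ∈ Ioc α β
  · rw [indicator_of_mem hx, h.eq_add (left_mem_Icc.2 hαβ) (Ioc_subset_Icc_self hx), h0, zero_add]
    refine intervalIntegral.integral_congr_ae (Eventually.of_forall fun t ht => ?_)
    rw [uIoc_of_le hx.1.le] at ht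
    exact (indicator_of_mem (show t ∈ Ioc α β from ⟨ht.1, ht.2.trans hx.2⟩) _).symm
  rw [indicator_of_notMem hx]
  rcases le_or_gt x α with hxα | hxα
  · rw [intervalIntegral.integral_symm, intervalIntegral.integral_of_le hxα, eq_comm, neg_eq_zero]
    refine setIntegral_eq_zero_of_forall_eq_zero fun t ht => indicator_of_notMem ?_ _
    exact fun ht' => ht.2.not_gt ht'.1
  · have hxβ : β ≤ x := not_lt.1 fun hlt => hx ⟨hxα, hlt.le⟩
    have e : ∫ t in β..x, (Ioc α β).indicator G t = 0 := by
      rw [intervalIntegral.integral_of_le hxβ]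
      refine setIntegral_eq_zero_of_forall_eq_zero fun t ht => indicator_of_notMem ?_ _
      exact fun ht' => ht.1.not_ge ht'.2
    rw [← intervalIntegral.integral_add_adjacent_intervals (b := β) hi.intervalIntegrable
      hi.intervalIntegrable, e, add_zero]
    have e2 : ∫ t in α..β, (Ioc α β).indicator G t = ∫ t in α..β, G t := by
      refine intervalIntegral.integral_congr_ae (Eventually.of_forall fun t ht => ?_)
      rw [uIoc_of_le hαβ] at ht
      exact indicator_of_mem ht _
    rw [e2, ← h.sub_eq α (left_mem_Icc.2 hαβ) β (right_mem_Icc.2 hαβ), h0, h1, sub_zero]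

end global

/-! ### The differential equation on a short interval -/

section short

open scoped BoundedContinuousFunction

variable {H : Type*} [NormedAddCommGroup H] [InnerProductSpace ℂ H] [CompleteSpace H]
  [TopologicalSpace.SeparableSpace H] {a b : EReal} {V : ℝ → H →L[ℂ] H} {α β : ℝ}

theorem IsPotential.norm_integral_apply_le (hV : IsPotential a b V) (hα : α ∈ interval a b)
    (hβ : β ∈ interval a b) (hαβ : α ≤ β) (y : ℝ →ᵇ H) {x s : ℝ} (hx : x ∈ Icc α β)
    (hs : s ∈ Icc α β) :
    ‖∫ t in x..s, V t (y t)‖ ≤ (∫ t in α..β, ‖V t‖) * ‖y‖ := by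
  have hVi := hV.intervalIntegrable_norm hα hβ
  refine intervalIntegral.norm_integral_le_integral_norm_uIoc.trans ?_
  rw [intervalIntegral.integral_of_le hαβ, ← integral_mul_const]
  have hsub : uIoc x s ⊆ Ioc α β := fun t ht =>
    ⟨(le_min hx.1 hs.1).trans_lt ht.1, ht.2.trans (max_le hx.2 hs.2)⟩
  have h1 := (intervalIntegrable_iff_integrableOn_Ioc_of_le hαβ).1
    (hV.intervalIntegrable_apply hα hβ hαβ (y := y) y.continuous.continuousOn)
  have h2 := (intervalIntegrable_iff_integrableOn_Ioc_of_le hαβ).1 hVi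
  refine (setIntegral_mono_set h1.norm (Eventually.of_forall fun _ => norm_nonneg _)
    hsub.eventuallyLE).trans ?_
  exact integral_mono h1.norm (h2.mul_const _) fun t =>
    ((V t).le_opNorm _).trans (mul_le_mul_of_nonneg_left (y.norm_coe_le_norm t) (norm_nonneg _))

/-- On a short interval the Volterra operator `T y = ∫∫ V y` is a contraction. It acts on bounded
continuous functions on `ℝ` rather than on `[α, β]`: `T y` is continued by its boundary values. -/
theorem IsPotential.exists_volterra (hV : IsPotential a b V) (hα : α ∈ interval a b)
    (hβ : β ∈ interval a b) (hαβ : α ≤ β) (hsmall : (β - α) * ∫ t in α..β, ‖V t‖ ≤ 1 / 5)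
    {x₀ : ℝ} (hx₀ : x₀ ∈ Icc α β) :
    ∃ T : (ℝ →ᵇ H) →L[ℂ] (ℝ →ᵇ H), ‖T‖ ≤ 1 / 5 ∧
      ∀ y, ∀ x ∈ Icc α β, T y x = ∫ s in x₀..x, ∫ t in x₀..s, V t (y t) := by
  have hA : ∀ y : ℝ →ᵇ H, IntervalIntegrable (fun x => V x (y x)) volume α β := fun y =>
    hV.intervalIntegrable_apply hα hβ hαβ y.continuous.continuousOn
  have hAc : ∀ y : ℝ →ᵇ H, ContinuousOn (fun s => ∫ t in x₀..s, V t (y t)) (Icc α β) := by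
    intro y
    have := intervalIntegral.continuousOn_primitive_interval' (hA y)
      (a := x₀) (by rwa [uIcc_of_le hαβ])
    rwa [uIcc_of_le hαβ] at this
  have hAi : ∀ y : ℝ →ᵇ H,
      IntervalIntegrable (fun s => ∫ t in x₀..s, V t (y t)) volume α β := fun y =>
    ContinuousOn.intervalIntegrable (by rw [uIcc_of_le hαβ]; exact hAc y)
  have hcont : ∀ y : ℝ →ᵇ H, Continuous
      fun x : ℝ => ∫ s in x₀..(projIcc α β hαβ x : ℝ), ∫ t in x₀..s, V t (y t) := by
    intro y
    have := intervalIntegral.continuousOn_primitive_interval' (hAi y)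
      (a := x₀) (by rwa [uIcc_of_le hαβ])
    rw [uIcc_of_le hαβ] at this
    exact this.comp_continuous (continuous_subtype_val.comp continuous_projIcc)
      fun x => (projIcc α β hαβ x).2
  have hbound : ∀ (y : ℝ →ᵇ H) (x : ℝ),
      ‖∫ s in x₀..(projIcc α β hαβ x : ℝ), ∫ t in x₀..s, V t (y t)‖ ≤ 1 / 5 * ‖y‖ := by
    intro y x
    have hx := (projIcc α β hαβ x).2
    refine (intervalIntegral.norm_integral_le_of_norm_le_const
      (C := (∫ t in α..β, ‖V t‖) * ‖y‖) fun s hs => ?_).trans ?_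
    · refine hV.norm_integral_apply_le hα hβ hαβ y hx₀ ?_
      exact uIcc_subset_Icc hx₀ hx (uIoc_subset_uIcc hs)
    · have h1 : |(projIcc α β hαβ x : ℝ) - x₀| ≤ β - α := by
        rw [abs_le]
        constructor <;> linarith [hx.1, hx.2, hx₀.1, hx₀.2]
      have h2 : 0 ≤ ∫ t in α..β, ‖V t‖ :=
        intervalIntegral.integral_nonneg hαβ fun _ _ => norm_nonneg _
      calc (∫ t in α..β, ‖V t‖) * ‖y‖ * |(projIcc α β hαβ x : ℝ) - x₀|
          ≤ (∫ t in α..β, ‖V t‖) * ‖y‖ * (β - α) :=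
            mul_le_mul_of_nonneg_left h1 (mul_nonneg h2 (norm_nonneg _))
        _ = (β - α) * (∫ t in α..β, ‖V t‖) * ‖y‖ := by ring
        _ ≤ 1 / 5 * ‖y‖ := mul_le_mul_of_nonneg_right hsmall (norm_nonneg _)
  let T₀ : (ℝ →ᵇ H) →ₗ[ℂ] (ℝ →ᵇ H) :=
    { toFun := fun y => BoundedContinuousFunction.ofNormedAddCommGroup _ (hcont y) _ (hbound y)
      map_add' := by
        intro y z
        ext x
        have hx := (projIcc α β hαβ x).2
        have e : ∀ s ∈ uIcc x₀ (projIcc α β hαβ x : ℝ), ∫ t in x₀..s, V t ((y + z) t) =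
            (∫ t in x₀..s, V t (y t)) + ∫ t in x₀..s, V t (z t) := by
          intro s hs
          have hs' := uIcc_subset_Icc hx₀ hx hs
          rw [← intervalIntegral.integral_add (intervalIntegrable_of_mem_Icc (hA y) hx₀ hs')
            (intervalIntegrable_of_mem_Icc (hA z) hx₀ hs')]
          simp
        simp only [BoundedContinuousFunction.coe_ofNormedAddCommGroup,
          BoundedContinuousFunction.coe_add, Pi.add_apply]
        rw [← intervalIntegral.integral_add (intervalIntegrable_of_mem_Icc (hAi y) hx₀ hx)
            (intervalIntegrable_of_mem_Icc (hAi z) hx₀ hx)]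
        exact intervalIntegral.integral_congr e
      map_smul' := by
        intro c y
        ext x
        simp [intervalIntegral.integral_smul] }
  refine ⟨T₀.mkContinuous (1 / 5) fun y => ?_, LinearMap.mkContinuous_norm_le _ (by norm_num) _,
    fun y x hx => ?_⟩
  · exact BoundedContinuousFunction.norm_ofNormedAddCommGroup_le _ (by positivity) (hbound y)
  · change ∫ s in x₀..(projIcc α β hαβ x : ℝ), ∫ t in x₀..s, V t (y t) = _
    rw [projIcc_of_mem hαβ hx]

/-- The solution operator `R = (1 - T)⁻¹` on a short interval, where `T y = ∫∫ V y` with base point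
`x₀`. It maps `p` with `p'' = -h` to the solution of `-y'' + V y = h` with the Cauchy data of `p` at
`x₀`, and it is close to the identity. -/
theorem IsPotential.exists_resolvent (hV : IsPotential a b V) (hα : α ∈ interval a b)
    (hβ : β ∈ interval a b) (hαβ : α ≤ β) (hsmall : (β - α) * ∫ t in α..β, ‖V t‖ ≤ 1 / 5)
    {x₀ : ℝ} (hx₀ : x₀ ∈ Icc α β) :
    ∃ R : (ℝ →ᵇ H) →L[ℂ] (ℝ →ᵇ H), (∀ p, ‖R p - p‖ ≤ 1 / 4 * ‖p‖) ∧
      ∀ (p : ℝ →ᵇ H) (p₁ h : ℝ → H), IsPrimitiveOn α β p p₁ →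
        IsPrimitiveOn α β p₁ (fun x => - h x) →
        ∃ y₁ : ℝ → H, IsPrimitiveOn α β (R p) y₁ ∧
          IsPrimitiveOn α β y₁ (fun x => V x (R p x) - h x) ∧
          R p x₀ = p x₀ ∧ y₁ x₀ = p₁ x₀ := by
  obtain ⟨T, hT, hTy⟩ := hV.exists_volterra hα hβ hαβ hsmall hx₀
  obtain ⟨U, hU⟩ := isUnit_one_sub_of_norm_lt_one (x := T) (hT.trans_lt (by norm_num))
  refine ⟨(U⁻¹ : (_)ˣ).val, ?_⟩
  set R : (ℝ →ᵇ H) →L[ℂ] (ℝ →ᵇ H) := (U⁻¹ : (_)ˣ).val with hR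
  have hfix : ∀ p, R p = p + T (R p) := by
    intro p
    have h1 : (1 - T) * R = 1 := by rw [← hU, hR, Units.mul_inv]
    have h2 := congrArg (fun S : (ℝ →ᵇ H) →L[ℂ] (ℝ →ᵇ H) => S p) h1
    simp only [mul_apply_eq_comp, sub_apply, one_apply_eq_self] at h2
    exact sub_eq_iff_eq_add.1 h2
  constructor
  · intro p
    have h1 : ‖R p - p‖ ≤ 1 / 5 * ‖R p‖ := by
      conv_lhs => rw [hfix p, add_sub_cancel_left]
      exact (T.le_opNorm _).trans (mul_le_mul_of_nonneg_right hT (norm_nonneg _))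
    have h2 : ‖R p‖ ≤ ‖R p - p‖ + ‖p‖ := by
      simpa using norm_add_le (R p - p) p
    linarith
  · intro p p₁ h hp hp₁
    have hA := hV.intervalIntegrable_apply hα hβ hαβ (y := R p) (R p).continuous.continuousOn
    set A : ℝ → H := fun s => ∫ t in x₀..s, V t (R p t) with hAdef
    have hAp : IsPrimitiveOn α β A (fun x => V x (R p x)) :=
      isPrimitiveOn_of_base (c := 0) hx₀ hA fun x _ => by rw [zero_add]
    have hAi : IntervalIntegrable A volume α β :=
      ContinuousOn.intervalIntegrable (by rw [uIcc_of_le hαβ]; exact hAp.continuousOn)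
    have hval : ∀ x ∈ Icc α β, R p x = p x + ∫ s in x₀..x, A s := by
      intro x hx
      conv_lhs => rw [hfix p]
      rw [BoundedContinuousFunction.add_apply, hTy _ x hx]
    refine ⟨p₁ + A, ?_, ?_, ?_, ?_⟩
    · refine isPrimitiveOn_of_base (c := p x₀) hx₀ (hp.intervalIntegrable.add hAi) fun x hx => ?_
      have e := intervalIntegral.integral_add
        (intervalIntegrable_of_mem_Icc hp.intervalIntegrable hx₀ hx)
        (intervalIntegrable_of_mem_Icc hAi hx₀ hx)
      simp only [Pi.add_apply]
      rw [hval x hx, hp.eq_add hx₀ hx, e, add_assoc]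
    · convert hp₁.add hAp using 1
      ext x
      simp only [Pi.add_apply]
      abel
    · rw [hval x₀ hx₀, intervalIntegral.integral_same, add_zero]
    · simp [hAdef]

/-- Existence for the inhomogeneous Cauchy problem with zero data at the left end point of a short
interval. -/
theorem IsPotential.exists_solution (hV : IsPotential a b V) (hα : α ∈ interval a b)
    (hβ : β ∈ interval a b) (hαβ : α ≤ β) (hsmall : (β - α) * ∫ t in α..β, ‖V t‖ ≤ 1 / 5)
    {h : ℝ → H} (hh : IntervalIntegrable h volume α β) :
    ∃ y y₁ : ℝ → H, IsPrimitiveOn α β y y₁ ∧ IsPrimitiveOn α β y₁ (fun x => V x (y x) - h x) ∧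
      y α = 0 ∧ y₁ α = 0 := by
  have hαm : α ∈ Icc α β := left_mem_Icc.2 hαβ
  obtain ⟨R, -, hR⟩ := hV.exists_resolvent hα hβ hαβ hsmall hαm
  set P₁ : ℝ → H := fun x => ∫ t in α..x, - h t with hP₁
  have hP₁p : IsPrimitiveOn α β P₁ (fun x => - h x) :=
    isPrimitiveOn_of_base (c := 0) hαm hh.neg fun x _ => by rw [zero_add]
  have hP₁i : IntervalIntegrable P₁ volume α β :=
    ContinuousOn.intervalIntegrable (by rw [uIcc_of_le hαβ]; exact hP₁p.continuousOn)
  set P : ℝ → H := fun x => ∫ t in α..x, P₁ t with hP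
  have hPp : IsPrimitiveOn α β P P₁ :=
    isPrimitiveOn_of_base (c := 0) hαm hP₁i fun x _ => by rw [zero_add]
  obtain ⟨C, hC⟩ := isCompact_Icc.exists_bound_of_continuousOn hPp.continuousOn
  let p : ℝ →ᵇ H := BoundedContinuousFunction.ofNormedAddCommGroup
    (fun x => P (projIcc α β hαβ x))
    (hPp.continuousOn.comp_continuous (continuous_subtype_val.comp continuous_projIcc)
      fun x => (projIcc α β hαβ x).2) C fun x => hC _ (projIcc α β hαβ x).2
  have hpP : ∀ x ∈ Icc α β, p x = P x := fun x hx => by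
    change P (projIcc α β hαβ x) = _
    rw [projIcc_of_mem hαβ hx]
  have hpp : IsPrimitiveOn α β p P₁ :=
    ⟨hP₁i, fun x hx y hy => by rw [hpP x hx, hpP y hy, hPp.sub_eq x hx y hy]⟩
  obtain ⟨y₁, h1, h2, h3, h4⟩ := hR p P₁ h hpp hP₁p
  refine ⟨R p, y₁, h1, h2, ?_, ?_⟩
  · rw [h3, hpP α hαm]
    exact intervalIntegral.integral_same
  · rw [h4]
    exact intervalIntegral.integral_same

omit [CompleteSpace H] [TopologicalSpace.SeparableSpace H] in
/-- The squared `L²` norm of an affine function, written with respect to the midpoint, where the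
mixed term integrates to zero. -/
theorem integral_norm_sq_affine (c d : H) (α β : ℝ) :
    ∫ x in α..β, ‖c + (x - (α + β) / 2) • d‖ ^ 2 =
      (β - α) * ‖c‖ ^ 2 + (β - α) ^ 3 / 12 * ‖d‖ ^ 2 := by
  set κ : ℝ := RCLike.re (inner ℂ c d) with hκ
  have e : ∀ x : ℝ, ‖c + (x - (α + β) / 2) • d‖ ^ 2 =
      ‖c‖ ^ 2 + 2 * κ * (x - (α + β) / 2) + ‖d‖ ^ 2 * (x - (α + β) / 2) ^ 2 := by
    intro x
    rw [norm_add_sq (𝕜 := ℂ), norm_smul, mul_pow, Real.norm_eq_abs, sq_abs,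
      ← Complex.coe_smul, inner_smul_right]
    rw [hκ, RCLike.re_eq_complex_re, Complex.re_ofReal_mul]
    ring
  rw [intervalIntegral.integral_eq_sub_of_hasDerivAt (f := fun x =>
    ‖c‖ ^ 2 * x + κ * (x - (α + β) / 2) ^ 2 + ‖d‖ ^ 2 * (x - (α + β) / 2) ^ 3 / 3)]
  · ring
  · intro x _
    have hx := (hasDerivAt_id x).sub_const ((α + β) / 2)
    have := (((hasDerivAt_id x).const_mul (‖c‖ ^ 2)).add ((hx.pow 2).const_mul κ)).add
      (((hx.pow 3).const_mul (‖d‖ ^ 2)).div_const 3)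
    rw [e]
    refine this.congr_deriv ?_
    simp
    ring
  · exact Continuous.intervalIntegrable (by fun_prop) _ _

omit [CompleteSpace H] [TopologicalSpace.SeparableSpace H] in
theorem norm_sq_eq_integral {X : Type*} [MeasurableSpace X] {μ : Measure X} (f : Lp H 2 μ) :
    ‖f‖ ^ 2 = ∫ x, ‖f x‖ ^ 2 ∂μ := by
  have h1 : ((‖f‖ ^ 2 : ℝ) : ℂ) = inner ℂ f f := by
    rw [inner_self_eq_norm_sq_to_K]
    norm_cast
  rw [L2.inner_def] at h1
  have h2 : ∀ x, inner ℂ (f x) (f x) = ((‖f x‖ ^ 2 : ℝ) : ℂ) := fun x => by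
    rw [inner_self_eq_norm_sq_to_K]
    norm_cast
  simp only [h2] at h1
  rw [integral_complex_ofReal] at h1
  exact_mod_cast h1

/-- On a short interval the solutions of `-y'' + V y = 0` form a closed subspace of `L²`, and they
attain all Cauchy data at the right end point. Closedness holds because solutions are so close to
affine functions that their Cauchy data are controlled by their `L²` norm. -/
theorem IsPotential.exists_solutionSpace (hV : IsPotential a b V) (hα : α ∈ interval a b)
    (hβ : β ∈ interval a b) (hαβ : α < β) (hsmall : (β - α) * ∫ t in α..β, ‖V t‖ ≤ 1 / 5) :
    ∃ N : Submodule ℂ (Lp H 2 (volume.restrict (Ioc α β))), IsClosed (N : Set (Lp H 2 (volume.restrict (Ioc α β)))) ∧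
      (∀ n ∈ N, ∃ y y₁ : ℝ → H, n =ᵐ[volume.restrict (Ioc α β)] y ∧ IsPrimitiveOn α β y y₁ ∧
        IsPrimitiveOn α β y₁ (fun x => V x (y x))) ∧
      ∀ c d : H, ∃ n ∈ N, ∃ y y₁ : ℝ → H, n =ᵐ[volume.restrict (Ioc α β)] y ∧
        IsPrimitiveOn α β y y₁ ∧ IsPrimitiveOn α β y₁ (fun x => V x (y x)) ∧
        y β = c ∧ y₁ β = d := by
  have hβm : β ∈ Icc α β := right_mem_Icc.2 hαβ.le
  -- The solution space is the range of `S (c, d) = R (c + (x - m) d)`, where `m` is the midpoint.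
  obtain ⟨R, hRn, hR⟩ := hV.exists_resolvent hα hβ hαβ.le hsmall hβm
  set r : ℝ := (β - α) / 2 with hr
  set m : ℝ := (α + β) / 2 with hm
  have hr0 : 0 < r := by rw [hr]; linarith
  have hclamp : ∀ x : ℝ, |(projIcc α β hαβ.le x : ℝ) - m| ≤ r := fun x => by
    have := (projIcc α β hαβ.le x).2
    rw [abs_le]
    constructor <;> linarith [this.1, this.2]
  have hbd : ∀ (q : H × H) (x : ℝ), ‖q.1 + ((projIcc α β hαβ.le x : ℝ) - m) • q.2‖ ≤
      ‖q.1‖ + r * ‖q.2‖ := fun q x => by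
    refine (norm_add_le _ _).trans ?_
    rw [norm_smul, Real.norm_eq_abs]
    gcongr
    exact hclamp x
  have hct : ∀ q : H × H, Continuous
      fun x : ℝ => q.1 + ((projIcc α β hαβ.le x : ℝ) - m) • q.2 := fun q =>
    continuous_const.add ((((continuous_subtype_val.comp continuous_projIcc)).sub
      continuous_const).smul continuous_const)
  let aff₀ : (H × H) →ₗ[ℂ] (ℝ →ᵇ H) :=
    { toFun := fun q => BoundedContinuousFunction.ofNormedAddCommGroup _ (hct q) _ (hbd q)
      map_add' := by
        intro q q'
        ext x
        simp only [BoundedContinuousFunction.coe_ofNormedAddCommGroup,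
          BoundedContinuousFunction.coe_add, Pi.add_apply, Prod.fst_add, Prod.snd_add, smul_add]
        abel
      map_smul' := by
        intro k q
        ext x
        simp only [BoundedContinuousFunction.coe_ofNormedAddCommGroup,
          BoundedContinuousFunction.coe_smul, Prod.smul_fst, Prod.smul_snd,
          RingHom.id_apply, smul_add]
        rw [smul_comm] }
  have haffn : ∀ q, ‖aff₀ q‖ ≤ ‖q.1‖ + r * ‖q.2‖ := fun q =>
    BoundedContinuousFunction.norm_ofNormedAddCommGroup_le _ (by positivity) (hbd q)
  have haffx : ∀ q, ∀ x ∈ Icc α β, aff₀ q x = q.1 + (x - m) • q.2 := fun q x hx => by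
    change q.1 + ((projIcc α β hαβ.le x : ℝ) - m) • q.2 = _
    rw [projIcc_of_mem hαβ.le hx]
  let aff : (H × H) →L[ℂ] (ℝ →ᵇ H) := aff₀.mkContinuous (1 + r) fun q => by
    refine (haffn q).trans ?_
    rw [add_mul, one_mul]
    gcongr
    · exact norm_fst_le q
    · exact norm_snd_le q
  let S : (H × H) →L[ℂ] Lp H 2 (volume.restrict (Ioc α β)) :=
    (BoundedContinuousFunction.toLp 2 (volume.restrict (Ioc α β)) ℂ).comp (R.comp aff)
  have hScoe : ∀ q, S q =ᵐ[volume.restrict (Ioc α β)] R (aff q) := fun q =>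
    BoundedContinuousFunction.coeFn_toLp _ _ _ _
  have hprim : ∀ q : H × H, ∃ y₁ : ℝ → H, IsPrimitiveOn α β (R (aff q)) y₁ ∧
      IsPrimitiveOn α β y₁ (fun x => V x (R (aff q) x)) ∧
      R (aff q) β = q.1 + (β - m) • q.2 ∧ y₁ β = q.2 := by
    intro q
    obtain ⟨y₁, h1, h2, h3, h4⟩ := hR (aff q) (fun _ => q.2) 0
      ⟨intervalIntegrable_const, fun x hx y hy => by
        rw [intervalIntegral.integral_const]
        change aff₀ q y - aff₀ q x = _
        rw [haffx q x hx, haffx q y hy]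
        module⟩
      ⟨by simp, fun x _ y _ => by simp⟩
    refine ⟨y₁, h1, by simpa using h2, h3.trans (haffx q β hβm), h4⟩
  -- With `p` the affine function and `y` the solution, `‖y - p‖ ≤ M / 4` in the supremum norm while
  -- `∫ ‖p‖² ≥ r M² / 3`, hence `∫ ‖y‖² ≥ r M² / 24`.
  have hlow : ∀ q : H × H, ‖q.1‖ + r * ‖q.2‖ ≤ √(24 / r) * ‖S q‖ := by
    intro q
    set M := ‖q.1‖ + r * ‖q.2‖ with hM
    have hM0 : 0 ≤ M := by positivity
    have hy : ‖S q‖ ^ 2 = ∫ x in α..β, ‖R (aff q) x‖ ^ 2 := by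
      rw [norm_sq_eq_integral, intervalIntegral.integral_of_le hαβ.le]
      refine integral_congr_ae ?_
      filter_upwards [hScoe q] with x hx
      rw [hx]
    have hp := integral_norm_sq_affine q.1 q.2 α β
    have hle : ∫ x in α..β, ‖q.1 + (x - (α + β) / 2) • q.2‖ ^ 2 ≤
        ∫ x in α..β, (2 * ‖R (aff q) x‖ ^ 2 + 2 * (1 / 4 * M) ^ 2) := by
      refine intervalIntegral.integral_mono_on hαβ.le
        (Continuous.intervalIntegrable (by fun_prop) _ _)
        (Continuous.intervalIntegrable (by fun_prop) _ _) fun x hx => ?_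
      rw [← hm, ← haffx q x hx]
      have h1 : ‖R (aff q) x - aff₀ q x‖ ≤ 1 / 4 * M := by
        refine ((R (aff q) - aff q).norm_coe_le_norm x).trans ((hRn _).trans ?_)
        gcongr
        exact haffn q
      have h2 : ‖aff₀ q x‖ ≤ ‖R (aff q) x‖ + 1 / 4 * M := by
        have := norm_sub_le (R (aff q) x) (R (aff q) x - aff₀ q x)
        rw [sub_sub_cancel] at this
        linarith
      have h3 := pow_le_pow_left₀ (norm_nonneg _) h2 2
      nlinarith [sq_nonneg (‖R (aff q) x‖ - 1 / 4 * M)]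
    rw [intervalIntegral.integral_add (Continuous.intervalIntegrable (by fun_prop) _ _)
      intervalIntegrable_const, intervalIntegral.integral_const_mul, ← hy, hp,
      intervalIntegral.integral_const, smul_eq_mul] at hle
    have hβα : β - α = 2 * r := by rw [hr]; ring
    rw [hβα] at hle
    have h5 : r * M ^ 2 ≤ 24 * ‖S q‖ ^ 2 := by
      have h6 : M ^ 2 ≤ 2 * ‖q.1‖ ^ 2 + 2 * (r * ‖q.2‖) ^ 2 := by
        rw [hM]
        nlinarith [sq_nonneg (‖q.1‖ - r * ‖q.2‖)]
      have h7 := mul_le_mul_of_nonneg_left h6 hr0.le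
      have h8 : 0 ≤ r * ‖q.1‖ ^ 2 := by positivity
      nlinarith
    refine le_of_sq_le_sq ?_ (by positivity)
    rw [mul_pow, Real.sq_sqrt (by positivity), div_mul_eq_mul_div, le_div_iff₀ hr0]
    linarith
  have hanti : AntilipschitzWith (Real.toNNReal ((1 + r⁻¹) * √(24 / r))) S := by
    refine ContinuousLinearMap.antilipschitz_of_bound S fun q => ?_
    rw [Real.coe_toNNReal _ (by positivity), mul_assoc]
    refine le_trans ?_ (mul_le_mul_of_nonneg_left (hlow q) (by positivity))
    have e : (1 + r⁻¹) * (‖q.1‖ + r * ‖q.2‖) =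
        ‖q.1‖ + r * ‖q.2‖ + r⁻¹ * ‖q.1‖ + ‖q.2‖ := by
      field_simp
      ring
    rw [e, Prod.norm_def]
    have t1 : 0 ≤ r * ‖q.2‖ := by positivity
    have t2 : 0 ≤ r⁻¹ * ‖q.1‖ := by positivity
    exact max_le (by linarith [norm_nonneg q.2]) (by linarith [norm_nonneg q.1])
  refine ⟨S.range, ?_, ?_, ?_⟩
  · exact hanti.isClosed_range S.uniformContinuous
  · rintro n ⟨q, rfl⟩
    obtain ⟨y₁, h1, h2, -, -⟩ := hprim q
    exact ⟨R (aff q), y₁, hScoe q, h1, h2⟩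
  · intro c d
    -- Affine functions are parametrised at the midpoint `m`; pass to the data at `β`.
    obtain ⟨y₁, h1, h2, h3, h4⟩ := hprim (c - (β - m) • d, d)
    refine ⟨S (c - (β - m) • d, d), ⟨_, rfl⟩, R (aff _), y₁, hScoe _, h1, h2, ?_, h4⟩
    rw [h3, sub_add_cancel]

end short

/-! ### Regularity of weak solutions -/

section regularity

variable {H : Type*} [NormedAddCommGroup H] [InnerProductSpace ℂ H] [CompleteSpace H]
  {a b : EReal}

theorem Hmax_apply_ae (hab : a < b) (V : ℝ → H →L[ℂ] H) (f : (Hmax hab V).domain) :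
    Hmax hab V f =ᵐ[vol a b] tau a b V (f : L2 a b H) :=
  MemLp.coeFn_toLp f.2.2

theorem exists_mem_Hmax (hab : a < b) (V : ℝ → H →L[ℂ] H) {f h : L2 a b H} {f₁ : ℝ → H}
    (h1 : HasStrongDeriv a b f f₁) (h2 : HasStrongDeriv a b f₁ fun x => V x (f x) - h x) :
    ∃ hf : f ∈ (Hmax hab V).domain, Hmax hab V ⟨f, hf⟩ = h := by
  obtain ⟨h3, h4⟩ := memW21loc_of h1 h2
  have h5 : tau a b V f =ᵐ[vol a b] h := by
    filter_upwards [h4] with x hx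
    simp [tau, hx]
  have hf : f ∈ (Hmax hab V).domain := ⟨h3, (memLp_congr_ae h5).2 (Lp.memLp h)⟩
  exact ⟨hf, Lp.ext ((Hmax_apply_ae hab V ⟨f, hf⟩).trans h5)⟩

omit [CompleteSpace H] in
theorem integrable_inner_of_memLp {X : Type*} [MeasurableSpace X] {μ : Measure X} {u w : X → H}
    (hu : MemLp u 2 μ) (hw : MemLp w 2 μ) : Integrable (fun x => inner ℂ (u x) (w x)) μ := by
  refine (L2.integrable_inner (𝕜 := ℂ) (hu.toLp u) (hw.toLp w)).congr ?_
  filter_upwards [hu.coeFn_toLp, hw.coeFn_toLp] with x h1 h2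
  rw [h1, h2]

omit [InnerProductSpace ℂ H] [CompleteSpace H] in
theorem memLp_of_continuousOn {α β : ℝ} {u : ℝ → H} (hu : ContinuousOn u (Icc α β)) :
    MemLp u 2 (volume.restrict (Ioc α β)) := by
  obtain ⟨C, hC⟩ := isCompact_Icc.exists_bound_of_continuousOn hu
  refine MemLp.of_bound ((hu.aestronglyMeasurable measurableSet_Icc).mono_measure
    (Measure.restrict_mono Ioc_subset_Icc_self le_rfl)) C ?_
  filter_upwards [ae_restrict_mem measurableSet_Ioc] with x hx
  exact hC x (Ioc_subset_Icc_self hx)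

theorem integral_vol_eq_of_indicator {α β : ℝ} (hα : α ∈ interval a b) (hβ : β ∈ interval a b)
    (hαβ : α ≤ β) {φ ψ : ℝ → ℂ} (h : φ =ᵐ[vol a b] (Ioc α β).indicator ψ) :
    ∫ x, φ x ∂(vol a b) = ∫ x in α..β, ψ x := by
  rw [integral_congr_ae h, integral_indicator measurableSet_Ioc,
    Measure.restrict_restrict measurableSet_Ioc, intervalIntegral.integral_of_le hαβ,
    inter_eq_left.2 (Ioc_subset_Icc_self.trans ((ordConnected_interval a b).out hα hβ))]

/-- A function on `[α, β]` whose Cauchy data vanish at both ends, extended by zero, lies in the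
domain of the preminimal operator, so that it may be used as a test function. -/
theorem exists_mem_HminDot (hab : a < b) (V : ℝ → H →L[ℂ] H) {α β : ℝ}
    (hα : α ∈ interval a b) (hβ : β ∈ interval a b) (hαβ : α ≤ β) {g g₁ k : ℝ → H}
    (hg : IsPrimitiveOn α β g g₁) (hg₁ : IsPrimitiveOn α β g₁ fun x => V x (g x) - k x)
    (hk : MemLp k 2 (volume.restrict (Ioc α β)))
    (h1 : g α = 0) (h2 : g β = 0) (h3 : g₁ α = 0) (h4 : g₁ β = 0) :
    ∃ u : (HminDot hab V).domain, (u : L2 a b H) =ᵐ[vol a b] (Ioc α β).indicator g ∧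
      HminDot hab V u =ᵐ[vol a b] (Ioc α β).indicator k := by
  have hmem : ∀ {u : ℝ → H}, MemLp u 2 (volume.restrict (Ioc α β)) →
      MemLp ((Ioc α β).indicator u) 2 (vol a b) := fun hu =>
    ((memLp_indicator_iff_restrict measurableSet_Ioc).2 hu).mono_measure Measure.restrict_le_self
  have hgL : MemLp g 2 (volume.restrict (Ioc α β)) := memLp_of_continuousOn hg.continuousOn
  set f : L2 a b H := (hmem hgL).toLp _ with hf
  set h : L2 a b H := (hmem hk).toLp _ with hh
  have hfe : f =ᵐ[vol a b] (Ioc α β).indicator g := (hmem hgL).coeFn_toLp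
  have hhe : h =ᵐ[vol a b] (Ioc α β).indicator k := (hmem hk).coeFn_toLp
  have d1 := (hasStrongDeriv_indicator hα hαβ hg h1 h2).congr hfe.symm
  have d2 := hasStrongDeriv_indicator hα hαβ hg₁ h3 h4
  have e : (Ioc α β).indicator (fun x => V x (g x) - k x) =ᵐ[vol a b]
      fun x => V x (f x) - h x := by
    filter_upwards [hfe, hhe] with x hx hx'
    rw [hx, hx']
    by_cases hxm : x ∈ Ioc α β <;> simp [hxm]
  obtain ⟨hfm, hfv⟩ := exists_mem_Hmax hab V d1 (d2.congr_deriv e)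
  have hc : f ∈ compactlySupported a b H := by
    refine ⟨Icc α β, isCompact_Icc, (ordConnected_interval a b).out hα hβ, ?_⟩
    filter_upwards [hfe] with x hx hxn
    rw [hx, indicator_of_notMem fun hm => hxn (Ioc_subset_Icc_self hm)]
  refine ⟨⟨f, hc, hfm⟩, hfe, ?_⟩
  have : HminDot hab V ⟨f, hc, hfm⟩ = h := by
    rw [← hfv]
    exact LinearPMap.domRestrict_apply rfl
  rw [this]
  exact hhe

variable [TopologicalSpace.SeparableSpace H] {V : ℝ → H →L[ℂ] H}

omit [TopologicalSpace.SeparableSpace H] in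
/-- Around every point there is an interval so short that the Volterra operator contracts. -/
theorem IsPotential.exists_short (hV : IsPotential a b V) {x : ℝ} (hx : x ∈ interval a b) :
    ∃ α ∈ interval a b, ∃ β ∈ interval a b, α < x ∧ x < β ∧
      (β - α) * ∫ t in α..β, ‖V t‖ ≤ 1 / 5 := by
  obtain ⟨α₀, hα₀, β₀, hβ₀, h1, h2⟩ := exists_Ioo_interval hx
  have hVi := hV.intervalIntegrable_norm hα₀ hβ₀
  set C := ∫ t in α₀..β₀, ‖V t‖ with hC
  have hC0 : 0 ≤ C :=
    intervalIntegral.integral_nonneg (h1.trans h2).le fun _ _ => norm_nonneg _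
  set r := min (min (x - α₀) (β₀ - x)) (1 / (10 * (C + 1))) with hr
  have hr0 : 0 < r := lt_min (lt_min (sub_pos.2 h1) (sub_pos.2 h2)) (by positivity)
  have r1 : r ≤ x - α₀ := (min_le_left _ _).trans (min_le_left _ _)
  have r2 : r ≤ β₀ - x := (min_le_left _ _).trans (min_le_right _ _)
  have r3 : r ≤ 1 / (10 * (C + 1)) := min_le_right _ _
  have hs := (ordConnected_interval a b).out hα₀ hβ₀
  have hle : ∫ t in (x - r)..(x + r), ‖V t‖ ≤ C :=
    intervalIntegral.integral_mono_interval (by linarith) (by linarith) (by linarith)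
      (Eventually.of_forall fun _ => norm_nonneg _) hVi
  refine ⟨x - r, hs ⟨by linarith, by linarith⟩, x + r, hs ⟨by linarith, by linarith⟩,
    by linarith, by linarith, ?_⟩
  have hpos : 0 < 10 * (C + 1) := by positivity
  rw [le_div_iff₀ hpos] at r3
  have e : x + r - (x - r) = 2 * r := by ring
  rw [e]
  nlinarith [mul_le_mul_of_nonneg_left hle hr0.le]

/-- Fundamental lemma: if `⟪h, g⟫ = ⟪f, τ g⟫` for all `g` in the preminimal domain, then `f` solves
`-f'' + V f = h` near every point. Indeed, `f` minus a particular solution is orthogonal to every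
`k` that is orthogonal to the null solutions, because such a `k` is of the form `τ g` for a test
function `g`; as the null solutions form a closed space, the difference is a null solution. -/
theorem IsPotential.exists_local_solution (hab : a < b) (hV : IsPotential a b V) {f h : L2 a b H}
    (hfh : ∀ g : (HminDot hab V).domain, inner ℂ h (g : L2 a b H) = inner ℂ f (HminDot hab V g))
    {x : ℝ} (hx : x ∈ interval a b) :
    ∃ α ∈ interval a b, ∃ β ∈ interval a b, α < x ∧ x < β ∧
      ∃ y y₁ : ℝ → H, f =ᵐ[volume.restrict (Ioc α β)] y ∧ IsPrimitiveOn α β y y₁ ∧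
        IsPrimitiveOn α β y₁ fun x => V x (f x) - h x := by
  obtain ⟨α, hα, β, hβ, hαx, hxβ, hsmall⟩ := hV.exists_short hx
  refine ⟨α, hα, β, hβ, hαx, hxβ, ?_⟩
  have hαβ : α < β := hαx.trans hxβ
  set μ := volume.restrict (Ioc α β) with hμ
  have hμle : μ ≤ vol a b := restrict_Ioc_le_vol hα hβ
  have hfL : MemLp f 2 μ := (Lp.memLp f).mono_measure hμle
  have hhL : MemLp h 2 μ := (Lp.memLp h).mono_measure hμle
  have hint : ∀ {u : ℝ → H}, MemLp u 2 μ → IntervalIntegrable u volume α β := fun hu =>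
    (intervalIntegrable_iff_integrableOn_Ioc_of_le hαβ.le).2 (hu.integrable one_le_two)
  obtain ⟨v, v₁, hv, hv₁, hvα, hv₁α⟩ := hV.exists_solution hα hβ hαβ.le hsmall (hint hhL)
  have hvL : MemLp v 2 μ := memLp_of_continuousOn hv.continuousOn
  obtain ⟨N, hNc, hN1, hN2⟩ := hV.exists_solutionSpace hα hβ hαβ hsmall
  have hwL : MemLp (fun t => f t - v t) 2 μ := hfL.sub hvL
  have hw : hwL.toLp _ ∈ N := by
    have : CompleteSpace N := hNc.completeSpace_coe
    rw [← N.orthogonal_orthogonal, Submodule.mem_orthogonal]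
    intro k hk
    have hkL : MemLp k 2 μ := Lp.memLp k
    obtain ⟨g, g₁, hg, hg₁, hgα, hg₁α⟩ := hV.exists_solution hα hβ hαβ.le hsmall (hint hkL)
    have hgL : MemLp g 2 μ := memLp_of_continuousOn hg.continuousOn
    -- Pairing `k` with the null solution with Cauchy data `(-g' β, g β)` gives
    -- `‖g β‖² + ‖g' β‖² = 0`.
    obtain ⟨n, hn, y, y₁, hny, hy, hy₁, hyβ, hy₁β⟩ := hN2 (-g₁ β) (g β)
    have hnk : ∫ t in α..β, inner ℂ (y t) (k t) = 0 := by
      rw [← (Submodule.mem_orthogonal N k).1 hk n hn, L2.inner_def,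
        intervalIntegral.integral_of_le hαβ.le]
      refine integral_congr_ae ?_
      filter_upwards [hny] with t ht
      rw [ht]
    have hL := hV.lagrange hα hβ hαβ.le hy (h := 0) (by simpa using hy₁) hg hg₁
    simp only [Pi.zero_apply, inner_zero_left, sub_zero, hnk, hyβ, hy₁β, hgα, hg₁α,
      inner_zero_right, inner_neg_left, sub_neg_eq_add, inner_self_eq_norm_sq_to_K] at hL
    have hL' : ‖g β‖ ^ 2 + ‖g₁ β‖ ^ 2 = 0 := by
      rw [← Complex.ofReal_eq_zero]
      push_cast
      exact hL.symm
    have hgβ : g β = 0 := by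
      rw [← norm_eq_zero]
      nlinarith [norm_nonneg (g β), norm_nonneg (g₁ β)]
    have hg₁β : g₁ β = 0 := by
      rw [← norm_eq_zero]
      nlinarith [norm_nonneg (g β), norm_nonneg (g₁ β)]
    obtain ⟨u, hu, hτu⟩ := exists_mem_HminDot hab V hα hβ hαβ.le hg hg₁ hkL hgα hgβ hg₁α hg₁β
    have htest : ∫ t in α..β, inner ℂ (h t) (g t) = ∫ t in α..β, inner ℂ (f t) (k t) := by
      have := hfh u
      rw [L2.inner_def, L2.inner_def] at this
      rwa [integral_vol_eq_of_indicator hα hβ hαβ.le (ψ := fun t => inner ℂ (h t) (g t)),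
        integral_vol_eq_of_indicator hα hβ hαβ.le (ψ := fun t => inner ℂ (f t) (k t))] at this
      · filter_upwards [hτu] with t ht
        rw [ht]
        by_cases htm : t ∈ Ioc α β <;> simp [htm]
      · filter_upwards [hu] with t ht
        rw [ht]
        by_cases htm : t ∈ Ioc α β <;> simp [htm]
    have hLv := hV.lagrange hα hβ hαβ.le hv hv₁ hg hg₁
    rw [hgβ, hg₁β, hgα, hg₁α] at hLv
    simp only [inner_zero_right, sub_zero] at hLv
    have hii : ∀ {u w : ℝ → H}, MemLp u 2 μ → MemLp w 2 μ →
        IntervalIntegrable (fun t => inner ℂ (u t) (w t)) volume α β := fun hu hw =>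
      (intervalIntegrable_iff_integrableOn_Ioc_of_le hαβ.le).2 (integrable_inner_of_memLp hu hw)
    rw [intervalIntegral.integral_sub (hii hvL hkL) (hii hhL hgL), htest, sub_eq_zero] at hLv
    rw [inner_eq_zero_symm, L2.inner_def]
    have e : ∫ t, inner ℂ (hwL.toLp _ t) (k t) ∂μ =
        ∫ t in α..β, (inner ℂ (f t) (k t) - inner ℂ (v t) (k t)) := by
      rw [intervalIntegral.integral_of_le hαβ.le]
      refine integral_congr_ae ?_
      filter_upwards [hwL.coeFn_toLp] with t ht
      rw [ht, inner_sub_left]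
    rw [e, intervalIntegral.integral_sub (hii hfL hkL) (hii hvL hkL), hLv, sub_self]
  obtain ⟨y, y₁, hwy, hy, hy₁⟩ := hN1 _ hw
  have hfe : f =ᵐ[μ] v + y := by
    filter_upwards [hwy, hwL.coeFn_toLp] with t h1 h2
    rw [h2] at h1
    rw [Pi.add_apply, ← h1, add_sub_cancel]
  refine ⟨v + y, v₁ + y₁, hfe, hv.add hy, (hv₁.add hy₁).congr hαβ.le ?_⟩
  filter_upwards [hfe] with t ht
  simp only [ht, Pi.add_apply, map_add]
  abel

/-- Every weak solution belongs to the domain of the maximal operator. -/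
theorem IsPotential.exists_mem_Hmax_of_weak (hab : a < b) (hV : IsPotential a b V)
    {f h : L2 a b H}
    (hfh : ∀ g : (HminDot hab V).domain, inner ℂ h (g : L2 a b H) = inner ℂ f (HminDot hab V g)) :
    ∃ hf : f ∈ (Hmax hab V).domain, Hmax hab V ⟨f, hf⟩ = h := by
  obtain ⟨f₁, h1, h2⟩ := exists_hasStrongDeriv_of_locally hab
    fun x hx => hV.exists_local_solution hab hfh hx
  exact exists_mem_Hmax hab V h1 h2

end regularity

/-! ### The maximal operator is a formal adjoint of the preminimal operator -/

section symmetric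

variable {H : Type*} [NormedAddCommGroup H] [InnerProductSpace ℂ H] [CompleteSpace H]
  {a b : EReal} {V : ℝ → H →L[ℂ] H}

theorem exists_mem_interval_of_ae (hab : a < b) {p : ℝ → Prop} (h : ∀ᵐ x ∂(vol a b), p x) :
    ∃ x ∈ interval a b, p x := by
  have : NeBot (ae (vol a b)) := by
    rw [ae_neBot, Ne, Measure.restrict_eq_zero]
    exact ((isOpen_interval a b).measure_pos volume (interval_nonempty hab)).ne'
  obtain ⟨x, hx, hp⟩ := ((ae_restrict_mem (measurableSet_interval a b)).and h).exists
  exact ⟨x, hx, hp⟩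

/-- The differential expression is local. -/
theorem MemW21loc.ae_eq_zero_of_ae_eq_zero {f : ℝ → H} (hf : MemW21loc a b f) {a' b' : EReal}
    (hab' : a' < b') (hsub : interval a' b' ⊆ interval a b) (h0 : f =ᵐ[vol a' b'] 0) :
    strongDeriv a b f =ᵐ[vol a' b'] 0 ∧ tau a b V f =ᵐ[vol a' b'] 0 := by
  have h1 : strongDeriv a b f =ᵐ[vol a' b'] 0 :=
    (((hasStrongDeriv_strongDeriv hf.1).restrict hab' hsub).congr h0).eq_zero
  have h2 : strongDeriv a b (strongDeriv a b f) =ᵐ[vol a' b'] 0 :=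
    (((hasStrongDeriv_strongDeriv hf.2).restrict hab' hsub).congr h1).eq_zero
  refine ⟨h1, ?_⟩
  filter_upwards [h0, h2] with x hx hx'
  simp [tau, hx, hx']

/-- An element of `dom(H_max)` with compact support has vanishing Cauchy data near both end points
of `(a, b)`, and it vanishes together with its image under `τ` outside a compact interval. -/
theorem exists_compact_support (hab : a < b) {g : L2 a b H} (hg : MemW21loc a b g)
    (hc : g ∈ compactlySupported a b H) :
    ∃ y y₁ : ℝ → H, g =ᵐ[vol a b] y ∧ ∃ α ∈ interval a b, ∃ β ∈ interval a b, α ≤ β ∧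
      IsPrimitiveOn α β y y₁ ∧ IsPrimitiveOn α β y₁ (fun x => V x (y x) - tau a b V g x) ∧
      y α = 0 ∧ y₁ α = 0 ∧ y β = 0 ∧ y₁ β = 0 ∧
      g =ᵐ[vol a b] (Ioc α β).indicator y ∧
      tau a b V g =ᵐ[vol a b] (Ioc α β).indicator (tau a b V g) := by
  obtain ⟨K, hK, hKI, hgK⟩ := hc
  obtain ⟨α₀, hα₀, β₀, hβ₀, hαβ₀, hsub⟩ := exists_Ioo_of_isCompact hab hK hKI
  obtain ⟨y, y₁, hy, hy₁, hp⟩ := hg.exists_representatives (V := V)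
  have hsubl : interval a α₀ ⊆ interval a b := fun x hx => ⟨hx.1, hx.2.trans hα₀.2⟩
  have hsubr : interval β₀ b ⊆ interval a b := fun x hx => ⟨hβ₀.1.trans hx.1, hx.2⟩
  have hlel : vol a α₀ ≤ vol a b := Measure.restrict_mono hsubl le_rfl
  have hler : vol β₀ b ≤ vol a b := Measure.restrict_mono hsubr le_rfl
  have h0l : g =ᵐ[vol a α₀] 0 := by
    filter_upwards [ae_mono hlel hgK, ae_restrict_mem (measurableSet_interval a α₀)] with x hx hxm
    exact hx fun hxK => (EReal.coe_lt_coe_iff.1 hxm.2).not_gt (hsub hxK).1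
  have h0r : g =ᵐ[vol β₀ b] 0 := by
    filter_upwards [ae_mono hler hgK, ae_restrict_mem (measurableSet_interval β₀ b)] with x hx hxm
    exact hx fun hxK => (EReal.coe_lt_coe_iff.1 hxm.1).not_gt (hsub hxK).2
  obtain ⟨hl1, hl2⟩ := hg.ae_eq_zero_of_ae_eq_zero (V := V) hα₀.1 hsubl h0l
  obtain ⟨hr1, hr2⟩ := hg.ae_eq_zero_of_ae_eq_zero (V := V) hβ₀.2 hsubr h0r
  -- The representatives vanish almost everywhere outside `K`, so suitable end points exist.
  obtain ⟨α, hαl, hyα, hy₁α⟩ := exists_mem_interval_of_ae hα₀.1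
    (p := fun x => y x = 0 ∧ y₁ x = 0) (by
      filter_upwards [h0l, hl1, ae_mono hlel hy, ae_mono hlel hy₁] with x e1 e2 e3 e4
      exact ⟨e3 ▸ e1, e4 ▸ e2⟩)
  obtain ⟨β, hβr, hyβ, hy₁β⟩ := exists_mem_interval_of_ae hβ₀.2
    (p := fun x => y x = 0 ∧ y₁ x = 0) (by
      filter_upwards [h0r, hr1, ae_mono hler hy, ae_mono hler hy₁] with x e1 e2 e3 e4
      exact ⟨e3 ▸ e1, e4 ▸ e2⟩)
  have hαα₀ : α < α₀ := EReal.coe_lt_coe_iff.1 hαl.2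
  have hββ₀ : β₀ < β := EReal.coe_lt_coe_iff.1 hβr.1
  have hαβ : α ≤ β := (hαα₀.trans (hαβ₀.trans hββ₀)).le
  obtain ⟨p1, p2⟩ := hp α (hsubl hαl) β (hsubr hβr) hαβ
  have hout : ∀ {u : ℝ → H}, u =ᵐ[vol a α₀] 0 → u =ᵐ[vol β₀ b] 0 →
      ∀ᵐ x ∂(vol a b), x ∉ Ioc α β → u x = 0 := by
    intro u hul hur
    rw [EventuallyEq, ae_restrict_iff' (measurableSet_interval _ _)] at hul hur
    rw [ae_restrict_iff' (measurableSet_interval _ _)]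
    filter_upwards [hul, hur] with x e1 e2 hxI hxn
    rcases le_or_gt x α with hxα | hxα
    · exact e1 ⟨hxI.1, EReal.coe_lt_coe_iff.2 (hxα.trans_lt hαα₀)⟩
    · have hxβ : β < x := not_le.1 fun hle => hxn ⟨hxα, hle⟩
      exact e2 ⟨EReal.coe_lt_coe_iff.2 (hββ₀.trans hxβ), hxI.2⟩
  refine ⟨y, y₁, hy, α, hsubl hαl, β, hsubr hβr, hαβ, p1, p2, hyα, hy₁α, hyβ, hy₁β, ?_, ?_⟩
  · filter_upwards [hout h0l h0r, hy] with x e1 e2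
    by_cases hx : x ∈ Ioc α β
    · rw [indicator_of_mem hx, e2]
    · rw [indicator_of_notMem hx, e1 hx]
  · filter_upwards [hout hl2 hr2] with x e1
    by_cases hx : x ∈ Ioc α β
    · rw [indicator_of_mem hx]
    · rw [indicator_of_notMem hx, e1 hx]

theorem IsPotential.isFormalAdjoint (hab : a < b) (hV : IsPotential a b V) :
    (Hmax hab V).IsFormalAdjoint (HminDot hab V) := by
  intro f g
  obtain ⟨z, z₁, hz, -, hzp⟩ := f.2.1.exists_representatives (V := V)
  obtain ⟨y, y₁, hy, α, hα, β, hβ, hαβ, p1, p2, e1, e2, e3, e4, hgi, hτi⟩ :=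
    exists_compact_support hab (V := V) g.2.2.1 g.2.1
  obtain ⟨q1, q2⟩ := hzp α hα β hβ hαβ
  have hle := restrict_Ioc_le_vol hα hβ
  have hτf := Hmax_apply_ae hab V f
  have hτg : HminDot hab V g =ᵐ[vol a b] tau a b V (g : L2 a b H) :=
    Hmax_apply_ae hab V ⟨g, g.2.2⟩
  have hL := hV.lagrange hα hβ hαβ q1 q2 p1 p2
  rw [e1, e2, e3, e4] at hL
  simp only [inner_zero_right, sub_zero] at hL
  have hii : ∀ {u w : ℝ → H}, MemLp u 2 (vol a b) → MemLp w 2 (vol a b) →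
      IntervalIntegrable (fun t => inner ℂ (u t) (w t)) volume α β := fun hu hw =>
    (intervalIntegrable_iff_integrableOn_Ioc_of_le hαβ).2
      (integrable_inner_of_memLp (hu.mono_measure hle) (hw.mono_measure hle))
  have hzL : MemLp z 2 (vol a b) := (memLp_congr_ae hz).1 (Lp.memLp (f : L2 a b H))
  have hyL : MemLp y 2 (vol a b) := (memLp_congr_ae hy).1 (Lp.memLp (g : L2 a b H))
  rw [intervalIntegral.integral_sub (hii hzL g.2.2.2) (hii f.2.2 hyL), sub_eq_zero] at hL
  rw [L2.inner_def, L2.inner_def,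
    integral_vol_eq_of_indicator hα hβ hαβ
      (ψ := fun t => inner ℂ (tau a b V (f : L2 a b H) t) (y t)),
    integral_vol_eq_of_indicator hα hβ hαβ
      (ψ := fun t => inner ℂ (z t) (tau a b V (g : L2 a b H) t)), hL]
  · filter_upwards [hτg, hτi, hz] with t h1 h2 h3
    rw [h1, h2, h3]
    by_cases htm : t ∈ Ioc α β <;> simp [htm]
  · filter_upwards [hτf, hgi] with t h1 h2
    rw [h1, h2]
    by_cases htm : t ∈ Ioc α β <;> simp [htm]

variable [TopologicalSpace.SeparableSpace H]

/-- If `h` is orthogonal to the preminimal domain, then `f = 0` is a weak solution of `τ f = h`, so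
that `h = H_max 0 = 0`. -/
theorem IsPotential.dense_HminDot (hab : a < b) (hV : IsPotential a b V) :
    Dense ((HminDot hab V).domain : Set (L2 a b H)) := by
  rw [Submodule.dense_iff_topologicalClosure_eq_top, Submodule.topologicalClosure_eq_top_iff,
    Submodule.eq_bot_iff]
  intro h hh
  obtain ⟨hf, hfh⟩ := hV.exists_mem_Hmax_of_weak hab (f := 0) (h := h) fun g => by
    rw [inner_zero_left]
    exact (Submodule.mem_orthogonal' _ _).1 hh g g.2
  rw [← hfh]
  exact (Hmax hab V).map_zero

theorem IsPotential.Hmax_eq_adjoint (hab : a < b) (hV : IsPotential a b V) :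
    Hmax hab V = (HminDot hab V)† := by
  have hd := hV.dense_HminDot hab
  refine LinearPMap.eq_of_le_of_domain_eq
    (LinearPMap.IsFormalAdjoint.le_adjoint hd (hV.isFormalAdjoint hab).symm) ?_
  refine le_antisymm (LinearPMap.IsFormalAdjoint.le_adjoint hd (hV.isFormalAdjoint hab).symm).1 ?_
  intro f hf
  obtain ⟨hf', -⟩ := hV.exists_mem_Hmax_of_weak hab (f := f) (h := (HminDot hab V)† ⟨f, hf⟩)
    fun g => LinearPMap.adjoint_isFormalAdjoint hd ⟨f, hf⟩ g
  exact hf'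

end symmetric

/-! ### The second adjoint -/

/-- In a Hilbert space, taking the adjoint of a linear relation twice gives its closure. -/
theorem adjoint_adjoint_eq_topologicalClosure {E : Type*} [NormedAddCommGroup E]
    [InnerProductSpace ℂ E] [CompleteSpace E] (G : Submodule ℂ (E × E)) :
    G.adjoint.adjoint = G.topologicalClosure := by
  set e : WithLp 2 (E × E) ≃L[ℂ] E × E := WithLp.prodContinuousLinearEquiv 2 ℂ E E with he
  ext x
  have h1 : x ∈ G.adjoint.adjoint ↔ e.symm x ∈ (G.map (e.symm : E × E →ₗ[ℂ] _))ᗮᗮ := by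
    simp only [Submodule.mem_adjoint_iff, Submodule.mem_orthogonal]
    constructor
    · intro h u hu
      have h2 := h u.snd (-u.fst) fun p q hpq => by
        have := hu (e.symm (p, q)) ⟨(p, q), hpq, rfl⟩
        rw [WithLp.prod_inner_apply] at this
        rw [inner_neg_right, sub_neg_eq_add, add_comm]
        exact this
      rw [inner_neg_left, ← neg_add', neg_eq_zero] at h2
      rw [WithLp.prod_inner_apply]
      exact h2
    · intro h p q hpq
      have h2 := h (e.symm (-q, p)) fun w hw => by
        obtain ⟨⟨c, d⟩, hcd, rfl⟩ := hw
        have := hpq c d hcd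
        rw [WithLp.prod_inner_apply]
        change inner ℂ c (-q) + inner ℂ d p = 0
        rw [inner_neg_right, ← this]
        ring
      rw [WithLp.prod_inner_apply] at h2
      change inner ℂ (-q) x.1 + inner ℂ p x.2 = 0 at h2
      rw [inner_neg_left] at h2
      rw [← neg_eq_zero, ← h2]
      ring
  rw [h1, Submodule.orthogonal_orthogonal_eq_closure]
  change e.symm x ∈ closure (e.symm '' (G : Set (E × E))) ↔ x ∈ closure (G : Set (E × E))
  rw [← e.symm.image_closure]
  exact e.symm.injective.mem_set_image

end OperatorSchrodinger

theorem theorem3p4 {H : Type*} [NormedAddCommGroup H] [InnerProductSpace ℂ H]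
    [CompleteSpace H] [TopologicalSpace.SeparableSpace H]
    {a b : EReal} (hab : a < b) (V : ℝ → H →L[ℂ] H)
    (hV : OperatorSchrodinger.IsPotential a b V) :
    Dense ((OperatorSchrodinger.HminDot hab V).domain : Set (OperatorSchrodinger.L2 a b H)) ∧
    OperatorSchrodinger.Hmax hab V = (OperatorSchrodinger.HminDot hab V)† ∧
    (OperatorSchrodinger.Hmax hab V).IsClosed ∧
    (OperatorSchrodinger.HminDot hab V).IsFormalAdjoint (OperatorSchrodinger.HminDot hab V) ∧
    (OperatorSchrodinger.HminDot hab V).IsClosable ∧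
    (OperatorSchrodinger.Hmax hab V)† = (OperatorSchrodinger.HminDot hab V).closure ∧
    (OperatorSchrodinger.HminDot hab V).closure = OperatorSchrodinger.Hmin hab V := by
  have hd := hV.dense_HminDot hab
  have hadj := hV.Hmax_eq_adjoint hab
  have hclosed : (OperatorSchrodinger.Hmax hab V).IsClosed := by
    rw [hadj]
    exact LinearPMap.adjoint_isClosed hd
  have hle : OperatorSchrodinger.HminDot hab V ≤ OperatorSchrodinger.Hmax hab V :=
    LinearPMap.domRestrict_le
  have hclosable := hclosed.isClosable.leIsClosable hle
  have hdmax : Dense ((OperatorSchrodinger.Hmax hab V).domain :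
      Set (OperatorSchrodinger.L2 a b H)) := hd.mono hle.1
  refine ⟨hd, hadj, hclosed, fun f g => ?_, hclosable, ?_, rfl⟩
  · exact hV.isFormalAdjoint hab ⟨f, f.2.2⟩ g
  · refine LinearPMap.eq_of_eq_graph ?_
    rw [LinearPMap.adjoint_graph_eq_graph_adjoint hdmax, hadj,
      LinearPMap.adjoint_graph_eq_graph_adjoint hd,
      OperatorSchrodinger.adjoint_adjoint_eq_topologicalClosure,
      hclosable.graph_closure_eq_closure_graph]
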